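/- **Conventions.** A simplicial complex $X$ is *flag* if every finite nonempty set of pairwise adjacent vertices spans a simplex. For vertices write $v\sim w$ if $v=w$ or $v,w$ span an edge, and let $d$ be the combinatorial metric on the vertex set of a connected complex. $B_i(O)$ and $S_i(O)$ denote the full subcomplexes spanned by the vertices at distance at most $i$, respectively exactly $i$, from the vertex $O$. The link $X_\sigma$ of a simplex $\sigma$ consists of the simplices disjoint from $\sigma$ that together with $\sigma$ span a simplex. - $X$ is *$8$-located* if it is flag and every full homotopically trivial loop of length at most $8$ is contained in a $1$-ball. (A loop is a subcomplex that triangulates the circle; it is full if every simplex of $X$ with all its vertices on the loop belongs to the loop.) - $X$ has the *$SD'$-property* if it is flag and for every vertex $O$ and every integer $i\ge 1$: (T) for every edge $e$ in $S_{i+1}(O)$ the intersection $X_e\cap B_i(O)$ is non-empty; (V) for every vertex $v\in S_{i+1}(O)$ and any two vertices $u,w\in X_v\cap B_i(O)$ there is a vertex $t\in X_v\cap B_i(O)$ with $t\sim u$ and $t\sim w$. - For a simplicial automorphism (isometry) $h$ of $X$, the *translation length* is $|h|=\min_x d(h(x),x)$, over the vertices $x$ of $X$. The map $h$ is *hyperbolic*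 if it maps no simplex of $X$ onto itself. The *minimal displacement set* $\mathrm{Min}_X(h)$ is the full subcomplex spanned by the vertices $x$ with $d(h(x),x)=|h|$. For hyperbolic $h$, an *axis* of $h$ is an $h$-invariant bi-infinite geodesic of the $1$-skeleton. $\mathrm{Min}_X(h)$ is *a union of axes* if $$\mathrm{Min}_X(h)=\mathrm{span}\Big\{\bigcup\gamma \;\Big|\; \gamma \text{ is an axis of } h\Big\}.\qquad(2.1)$$ - For a hyperbolic $h$ satisfying $(2.1)$, the *graph of axes* $Y(h)$ has as vertices the axes of $h$ in $\mathrm{Min}_X(h)$; two distinct axes $\gamma_1,\gamma_2$ are joined by an edge if $d_{\min}(\gamma_1,\gamma_2)=\min\{d(x_1,x_2) : x_1\in\gamma_1,\ x_2\in\gamma_2\}\le 1$. Its vertex set carries the path metric $d_{Y(h)}$. **Theorem.** Let $X$ be a connected, locally finite, $8$-located simplicial complex with the $SD'$-property, and let $h$ be a hyperbolic isometry of $X$ with $|h|>3$ whose minimal displacement set is a union of axes, i.e. $h$ satisfies $(2.1)$. Then the graph of axes $Y(h)$ is connected, and $(Y(h),d_{Y(h)})$ is quasi-isometric to a simplicial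 tree. -/

import Mathlib

namespace LocatedComplex

/-! Throughout, a simplicial complex `K` with vertex set `V` is Mathlib's
`AbstractSimplicialComplex V`. Full subcomplexes (balls, spheres, spans, minimal displacement sets)
are given by their sets of vertices. Distances in `K` are only used when `K` is connected. -/

variable {V : Type*} (K : AbstractSimplicialComplex V)

/-- The set of vertices `A` is (the vertex set of) a simplex of `K`. -/
def IsSimplex (A : Set V) : Prop :=
  ∃ s ∈ K.faces, (s : Set V) = A

/-- `v ∼ w`: the vertices `v` and `w` are equal or span an edge. -/
def Near (v w : V) : Prop := IsSimplex K {v, w}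

/-- The `1`-skeleton of `K` as a simple graph. -/
def skel : SimpleGraph V where
  Adj v w := v ≠ w ∧ IsSimplex K {v, w}
  symm := ⟨fun v w h => ⟨h.1.symm, by
    have h2 := h.2
    rwa [Set.pair_comm] at h2⟩⟩
  loopless := ⟨fun _ h => h.1 rfl⟩

/-- The combinatorial metric on the vertices of a connected complex. -/
noncomputable def cdist (v w : V) : ℕ := (skel K).dist v w

/-- The vertices of the ball `B_i(O)`. -/
def ball (O : V) (i : ℕ) : Set V := {v | cdist K O v ≤ i}

/-- The vertices of the sphere `S_i(O)`. -/
def sphere (O : V) (i : ℕ) : Set V := {v | cdist K O v = i}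

/-- `K` is flag: every nonempty finite set of pairwise adjacent vertices spans a simplex. -/
def IsFlag : Prop :=
  ∀ s : Finset V, s.Nonempty → (∀ v ∈ s, ∀ w ∈ s, v ≠ w → (skel K).Adj v w) → s ∈ K.faces

/-- `K` is locally finite: every vertex lies in finitely many simplices. -/
def IsLocallyFinite : Prop :=
  ∀ v : V, {s : Finset V | s ∈ K.faces ∧ v ∈ s}.Finite

/-- The simplices of the link of `K` at a simplex `σ`. -/
def link (σ : Finset V) : Set (Finset V) :=
  {τ | τ ∈ K.faces ∧ Disjoint σ τ ∧ IsSimplex K ((σ : Set V) ∪ (τ : Set V))}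

/-- Edge-path homotopy relative to the endpoints: the congruence on edge paths that is generated by
removing or inserting a backtracking `u, v, u`, and by replacing two consecutive sides of a triangle
of `K` by the third side. Its classes are the elements of the edge-path groupoid of `K`, that is,
of the fundamental groupoid of the geometric realization restricted to the vertices. -/
inductive EdgeHomotopic : ∀ {u v : V}, (skel K).Walk u v → (skel K).Walk u v → Prop
  | refl {u v : V} (p : (skel K).Walk u v) : EdgeHomotopic p p
  | symm {u v : V} {p q : (skel K).Walk u v} : EdgeHomotopic p q → EdgeHomotopic q p
  | trans {u v : V} {p q r : (skel K).Walk u v} :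
      EdgeHomotopic p q → EdgeHomotopic q r → EdgeHomotopic p r
  | cons {u v w : V} (h : (skel K).Adj u v) {p q : (skel K).Walk v w} :
      EdgeHomotopic p q → EdgeHomotopic (SimpleGraph.Walk.cons h p) (SimpleGraph.Walk.cons h q)
  | backtrack {u v w : V} (h : (skel K).Adj u v) (p : (skel K).Walk u w) :
      EdgeHomotopic (SimpleGraph.Walk.cons h (SimpleGraph.Walk.cons h.symm p)) p
  | triangle {u v w x : V} (huv : (skel K).Adj u v) (hvw : (skel K).Adj v w)
      (huw : (skel K).Adj u w) (hT : IsSimplex K {u, v, w}) (p : (skel K).Walk w x) :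
      EdgeHomotopic (SimpleGraph.Walk.cons huv (SimpleGraph.Walk.cons hvw p))
        (SimpleGraph.Walk.cons huw p)

/-- The closed edge path `p` is homotopically trivial in `K`. -/
def IsHomotopicallyTrivial {v : V} (p : (skel K).Walk v v) : Prop :=
  EdgeHomotopic K p SimpleGraph.Walk.nil

/-- The closed edge path `p` runs once around a full cycle of `K`: it is a (simple) cycle, and each
simplex of `K` whose vertices lie on it is a vertex or an edge of the cycle. -/
def IsFullCycle {v : V} (p : (skel K).Walk v v) : Prop :=
  p.IsCycle ∧ ∀ s ∈ K.faces, (∀ x ∈ s, x ∈ p.support) →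
    (∃ x, s = {x}) ∨ ∃ e ∈ p.edges, ∀ x, x ∈ s ↔ x ∈ e

/-- `K` is `m`-located: it is flag and every full homotopically trivial loop of length at most `m`
is contained in a `1`-ball. -/
def IsLocated (m : ℕ) : Prop :=
  IsFlag K ∧ ∀ (v : V) (p : (skel K).Walk v v), IsFullCycle K p → IsHomotopicallyTrivial K p →
    p.length ≤ m → ∃ c : V, ∀ x ∈ p.support, x ∈ ball K c 1

/-- The triangle condition (T) for the radius `i`: for every edge `e` in `S_{i+1}(O)`, the link of
`e` meets `B_i(O)`. -/
def TriangleCondition (O : V) (i : ℕ) : Prop :=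
  ∀ e ∈ K.faces, e.card = 2 → (∀ x ∈ e, x ∈ sphere K O (i + 1)) →
    ∃ t ∈ ball K O i, {t} ∈ link K e

/-- The vertex condition (V) for the radius `i`: any two vertices `u, w` of `B_i(O)` in the link of
a vertex `v` of `S_{i+1}(O)` have a vertex `t ∼ u, w` in this link and in `B_i(O)`. -/
def VertexCondition (O : V) (i : ℕ) : Prop :=
  ∀ v ∈ sphere K O (i + 1), ∀ u ∈ ball K O i, ∀ w ∈ ball K O i,
    {u} ∈ link K {v} → {w} ∈ link K {v} →
      ∃ t ∈ ball K O i, {t} ∈ link K {v} ∧ Near K t u ∧ Near K t w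

/-- The property `SD'_n(O)` of a flag simplicial complex. -/
def SatisfiesSDn (O : V) (n : ℕ) : Prop :=
  ∀ i ∈ Finset.Icc 1 n, TriangleCondition K O i ∧ VertexCondition K O i

/-- The property `SD'`: the complex is flag and `SD'_n(O)` holds for all `n` and all `O`. -/
def SatisfiesSD : Prop :=
  IsFlag K ∧ ∀ (n : ℕ) (O : V), SatisfiesSDn K O n

/-- A (simplicial) isometry of `K`: a bijection of the vertices that preserves simplices in both
directions. -/
def IsSimplicialIsometry (h : V ≃ V) : Prop :=
  ∀ s : Finset V, s.map h.toEmbedding ∈ K.faces ↔ s ∈ K.faces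

/-- A simplicial isometry is hyperbolic if it maps no simplex onto itself. -/
def IsHyperbolic (h : V ≃ V) : Prop :=
  IsSimplicialIsometry K h ∧ ∀ s ∈ K.faces, s.map h.toEmbedding ≠ s

/-- The displacement function. -/
noncomputable def displacement (h : V ≃ V) (x : V) : ℕ := cdist K (h x) x

/-- The translation length `|h|`, the minimum of the displacement function. -/
noncomputable def translationLength (h : V ≃ V) : ℕ := ⨅ x, displacement K h x

/-- The vertices of the minimal displacement set. -/
def minSet (h : V ≃ V) : Set V := {x | displacement K h x = translationLength K h}

/-- A (bi-infinite) geodesic, parametrized by the integers. -/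
def IsGeodesicLine (γ : ℤ → V) : Prop :=
  ∀ a b : ℤ, cdist K (γ a) (γ b) = (a - b).natAbs

/-- The set `A` is the vertex set of an axis of `h`, that is, of an `h`-invariant geodesic. (Two
vertices of a geodesic are adjacent in `K` only if they are consecutive, so that a geodesic, as a
subcomplex, is determined by its vertices.) -/
def IsAxis (h : V ≃ V) (A : Set V) : Prop :=
  (∃ γ : ℤ → V, IsGeodesicLine K γ ∧ Set.range γ = A) ∧ h '' A = A

/-- The minimal displacement set is the span of the union of the axes of `h`. -/
def MinIsUnionOfAxes (h : V ≃ V) : Prop :=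
  minSet K h = ⋃₀ {A | IsAxis K h A}

/-- The distance `d_min` between two nonempty sets of vertices. -/
noncomputable def dMin (A B : Set V) : ℕ :=
  sInf {n | ∃ x ∈ A, ∃ y ∈ B, n = cdist K x y}

/-- The vertices of the graph of axes: the axes of `h` in the minimal displacement set. -/
def Axis (h : V ≃ V) : Type _ := {A : Set V // IsAxis K h A ∧ A ⊆ minSet K h}

theorem dMin_comm (A B : Set V) : dMin K A B = dMin K B A := by
  unfold dMin
  congr 1
  ext n
  constructor
  · rintro ⟨x, hx, y, hy, rfl⟩
    exact ⟨y, hy, x, hx, SimpleGraph.dist_comm⟩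
  · rintro ⟨x, hx, y, hy, rfl⟩
    exact ⟨y, hy, x, hx, SimpleGraph.dist_comm⟩

/-- The graph of axes: two distinct axes are adjacent if `d_min` of them is at most `1`. -/
def graphOfAxes (h : V ≃ V) : SimpleGraph (Axis K h) where
  Adj A B := A ≠ B ∧ dMin K A.1 B.1 ≤ 1
  symm := ⟨fun A B hAB => ⟨hAB.1.symm, by
    rw [dMin_comm]
    exact hAB.2⟩⟩
  loopless := ⟨fun _ hA => hA.1 rfl⟩

/-- A quasi-isometry between the vertex sets of two connected graphs with their path metrics. -/
def IsQuasiIsometry {W W' : Type*} (G : SimpleGraph W) (H : SimpleGraph W') (f : W → W') : Prop :=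
  ∃ L C : ℝ, 1 ≤ L ∧ 0 ≤ C ∧
    (∀ x y : W, (G.dist x y : ℝ) / L - C ≤ (H.dist (f x) (f y) : ℝ) ∧
      (H.dist (f x) (f y) : ℝ) ≤ L * (G.dist x y : ℝ) + C) ∧
    ∀ z : W', ∃ x : W, (H.dist (f x) z : ℝ) ≤ C

end LocatedComplex

universe u

/-! The theorem holds because the graph of axes is connected and finite: a bounded connected graph
is quasi-isometric to a one-point tree. Finiteness is no accident. In an `8`-located complex with
the property `SD'` the intervals between two vertices, or between two ends of axes, are thin, and
so any two axes of `h` stay at distance at most `2` from each other.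

*Local input.* The conditions (T) and (V) at a vertex allow pushing every edge path towards this
vertex, so that `K` is simply connected (`SatisfiesSD.isHomotopicallyTrivial`). Hence every induced
cycle of length between `4` and `8` in the `1`-skeleton has a center, a vertex adjacent to all of
it (`wheeled_skel`). The existence of these centers is all that is used of locatedness from then
on.

*Layers.* Let `α` and `β` be parametrized axes. The geodesics between the points `α (-M)` and
`β M`, for large `M`, make up layers `J k`, which satisfy (T) and (V) towards both ends
(`isLayering_layer`). A cycle of length at most `8` that meets `J k` and `J (k + 3)` has no center,
so it is not induced. The center of an induced cycle that meets `J (k - 1)` and `J (k + 1)` lies in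
`J k`. With these two facts, (T) and (V) show that if two vertices of one layer are
`IsLayering.Close`, that is, at distance at most `2` in this layer, then so are their neighbours in
the layer below (`IsLayering.close_below`). Any two vertices of one layer are reached in this way
from the single vertex `β M`, for large `M`, and are therefore close (`close_of_mem_layer`). This
applies to the vertices of `α` and `β` (`IsAxisLine.exists_layering`).

*Connectedness.* Suppose that `α` and `β` lie in different components. In each layer their vertices
have a common neighbour `x n`. The cycles formed by pieces of `α` and `β` between `x n` and
`x (n + 2)` or `x (n + 3)` have centers as soon as they are induced. A center that is adjacent to
two vertices `α n` and `α (n + 2)` can replace the vertex between them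
(`IsAxisLine.exists_replace`), which gives an axis that meets `α`; it is then not adjacent to `β`.
This leaves no room for the `x n` (`IsLayering.false_of_parallel`).

*Finiteness.* All axes meet a fixed finite ball in a fundamental domain for the action of `h`,
which determines the axis (`finite_axis`). -/

namespace LocatedComplex

/-! ### Induced cycles and chains in graphs -/

/-- The vertices `x` and `y` are equal or adjacent in the graph `G`. -/
def AdjOrEq {V : Type*} (G : SimpleGraph V) (x y : V) : Prop := x = y ∨ G.Adj x y

/-- Every induced cycle of `G` of length between `4` and `8` is the rim of a wheel. The cycle is
given by the values of `f` at `0, …, n - 1`. -/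
def Wheeled {V : Type*} (G : SimpleGraph V) : Prop :=
  ∀ (n : ℕ) (f : ℕ → V), 4 ≤ n → n ≤ 8 →
    (∀ i j, i < j → j < n → AdjOrEq G (f i) (f j) → j = i + 1 ∨ (i = 0 ∧ j + 1 = n)) →
    (∀ i, i + 1 < n → G.Adj (f i) (f (i + 1))) → G.Adj (f 0) (f (n - 1)) →
    ∃ c, ∀ i < n, G.Adj c (f i)

/-- The values of `q` at `0, …, n` form an induced path of `G`. -/
structure IsInducedPath {V : Type*} (G : SimpleGraph V) (n : ℕ) (q : ℕ → V) : Prop where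
  adj : ∀ i < n, G.Adj (q i) (q (i + 1))
  succ_of_adjOrEq : ∀ i j, i < j → j ≤ n → AdjOrEq G (q i) (q j) → j = i + 1

/-- There are `q 0, …, q n` in `S`, consecutive ones equal or adjacent, such that `x` is adjacent to
`q 0` and `y` is adjacent to `q n`. -/
def Joined {V : Type*} (G : SimpleGraph V) (S : Set V) (n : ℕ) (x y : V) : Prop :=
  ∃ q : ℕ → V, (∀ j ≤ n, q j ∈ S) ∧ (∀ j < n, AdjOrEq G (q j) (q (j + 1))) ∧
    G.Adj x (q 0) ∧ G.Adj y (q n)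

section Graph

variable {V : Type*} {G : SimpleGraph V}

theorem AdjOrEq.symm {x y : V} (h : AdjOrEq G x y) : AdjOrEq G y x :=
  h.elim (fun h => .inl h.symm) (fun h => .inr h.symm)

theorem AdjOrEq.refl (x : V) : AdjOrEq G x x := .inl rfl

theorem Joined.mono {S S' : Set V} {n m : ℕ} {x y : V} (h : Joined G S n x y) (hS : S ⊆ S')
    (hnm : n ≤ m) : Joined G S' m x y := by
  obtain ⟨q, hqS, hq, hx, hy⟩ := h
  refine ⟨fun j => q (min j n), fun j _ => hS (hqS _ (by omega)), fun j hj => ?_,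
    by simpa using hx, by simpa [Nat.min_eq_right hnm] using hy⟩
  by_cases hjn : j < n
  · have h1 := hq j hjn
    simpa [Nat.min_eq_left hjn.le, Nat.min_eq_left (Nat.succ_le_of_lt hjn)] using h1
  · left
    simp only
    congr 1
    omega

theorem joined_zero {S : Set V} {x y u : V} (hu : u ∈ S) (hx : G.Adj x u) (hy : G.Adj y u) :
    Joined G S 0 x y :=
  ⟨fun _ => u, fun _ _ => hu, fun _ _ => .inl rfl, hx, hy⟩

theorem joined_one {S : Set V} {x y u v : V} (hu : u ∈ S) (hv : v ∈ S) (hx : G.Adj x u)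
    (huv : AdjOrEq G u v) (hy : G.Adj y v) : Joined G S 1 x y := by
  refine ⟨fun j => if j = 0 then u else v, fun j _ => ?_, fun j hj => ?_, by simpa, by simpa⟩
  · dsimp only
    split_ifs <;> assumption
  · obtain rfl : j = 0 := by omega
    simpa using huv

theorem joined_two {S : Set V} {x y u v w : V} (hu : u ∈ S) (hv : v ∈ S) (hw : w ∈ S)
    (hx : G.Adj x u) (huv : AdjOrEq G u v) (hvw : AdjOrEq G v w) (hy : G.Adj y w) :
    Joined G S 2 x y := by
  refine ⟨fun j => if j = 0 then u else if j = 1 then v else w, fun j _ => ?_, fun j hj => ?_,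
    by simpa, by simpa⟩
  · dsimp only
    split_ifs <;> assumption
  · obtain rfl | rfl : j = 0 ∨ j = 1 := by omega
    · simpa using huv
    · simpa using hvw

theorem joined_three {S : Set V} {x y u v w z : V} (hu : u ∈ S) (hv : v ∈ S) (hw : w ∈ S)
    (hz : z ∈ S) (hx : G.Adj x u) (huv : AdjOrEq G u v) (hvw : AdjOrEq G v w)
    (hwz : AdjOrEq G w z) (hy : G.Adj y z) : Joined G S 3 x y := by
  refine ⟨fun j => if j = 0 then u else if j = 1 then v else if j = 2 then w else z,
    fun j _ => ?_, fun j hj => ?_, by simpa, by simpa⟩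
  · dsimp only
    split_ifs <;> assumption
  · obtain rfl | rfl | rfl : j = 0 ∨ j = 1 ∨ j = 2 := by omega
    · simpa using huv
    · simpa using hvw
    · simpa using hwz

theorem Joined.exists_of_one {S : Set V} {x y : V} (h : Joined G S 1 x y) :
    ∃ u ∈ S, ∃ v ∈ S, G.Adj x u ∧ AdjOrEq G u v ∧ G.Adj y v := by
  obtain ⟨q, hS, hq, hx, hy⟩ := h
  exact ⟨q 0, hS 0 (by omega), q 1, hS 1 (by omega), hx, hq 0 (by omega), hy⟩

/-- A shortest chain is an induced path, and only its ends are adjacent to `x` and to `y`. -/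
theorem Joined.exists_induced {S : Set V} {n : ℕ} {x y : V} (h : Joined G S n x y) :
    ∃ m ≤ n, ∃ q : ℕ → V, (∀ j ≤ m, q j ∈ S) ∧ IsInducedPath G m q ∧
      G.Adj x (q 0) ∧ G.Adj y (q m) ∧
      (∀ j ≤ m, G.Adj x (q j) → j = 0) ∧ (∀ j ≤ m, G.Adj y (q j) → j = m) := by
  classical
  have hex : ∃ m, Joined G S m x y := ⟨n, h⟩
  obtain ⟨q, hS, hq, hx, hy⟩ := Nat.find_spec hex
  have hmin : ∀ m, m < Nat.find hex → ¬ Joined G S m x y := fun m hm => Nat.find_min hex hm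
  set m := Nat.find hex with hm
  have hskip : ∀ i j, i < j → j ≤ m → AdjOrEq G (q i) (q j) → j = i + 1 := by
    intro i j hij hjm hadj
    by_contra hne
    refine hmin (m - (j - i - 1)) (by omega)
      ⟨fun l => if l ≤ i then q l else q (l + (j - i - 1)), fun l hl => ?_, fun l hl => ?_,
        by simpa using hx, ?_⟩
    · dsimp only
      split_ifs
      · exact hS _ (by omega)
      · exact hS _ (by omega)
    · dsimp only
      by_cases h1 : l + 1 ≤ i
      · rw [if_pos (by omega), if_pos h1]
        exact hq l (by omega)
      · rw [if_neg h1]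
        by_cases h2 : l ≤ i
        · rw [if_pos h2]
          obtain rfl : l = i := by omega
          rwa [show l + 1 + (j - l - 1) = j by omega]
        · rw [if_neg h2, show l + 1 + (j - i - 1) = l + (j - i - 1) + 1 by omega]
          exact hq _ (by omega)
    · dsimp only
      rw [if_neg (by omega), show m - (j - i - 1) + (j - i - 1) = m by omega]
      exact hy
  refine ⟨m, Nat.find_min' hex h, q, hS, ⟨fun i hi => ?_, hskip⟩, hx, hy, fun j hj hxj => ?_,
    fun j hj hyj => ?_⟩
  · refine (hq i hi).resolve_left fun heq => ?_
    refine hmin (m - 1) (by omega) ⟨fun l => if l ≤ i then q l else q (l + 1), fun l hl => ?_,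
      fun l hl => ?_, by simpa using hx, ?_⟩
    · dsimp only
      split_ifs
      · exact hS _ (by omega)
      · exact hS _ (by omega)
    · dsimp only
      by_cases h1 : l + 1 ≤ i
      · rw [if_pos (by omega), if_pos h1]
        exact hq l (by omega)
      · rw [if_neg h1]
        by_cases h2 : l ≤ i
        · rw [if_pos h2]
          obtain rfl : l = i := by omega
          rw [heq]
          exact hq (l + 1) (by omega)
        · rw [if_neg h2]
          exact hq _ (by omega)
    · dsimp only
      by_cases h1 : m - 1 ≤ i
      · rw [if_pos h1, show m - 1 = i by omega, heq, show i + 1 = m by omega]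
        exact hy
      · rw [if_neg h1, show m - 1 + 1 = m by omega]
        exact hy
  · by_contra hne
    refine hmin (m - j) (by omega) ⟨fun l => q (l + j), fun l hl => hS _ (by omega),
      fun l hl => ?_, by simpa using hxj, ?_⟩
    · dsimp only
      rw [show l + 1 + j = l + j + 1 by omega]
      exact hq _ (by omega)
    · dsimp only
      rwa [show m - j + j = m by omega]
  · by_contra hne
    exact hmin j (by omega) ⟨q, fun l hl => hS _ (by omega), fun l hl => hq _ (by omega), hx, hyj⟩

/-- Two induced paths whose initial vertices are adjacent, whose final vertices are adjacent, and
that are otherwise unrelated, form an induced cycle. -/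
theorem Wheeled.exists_center (hG : Wheeled G) {a b : ℕ} {p q : ℕ → V} (ha : 1 ≤ a)
    (h2 : 2 ≤ a + b) (h6 : a + b ≤ 6) (hp : IsInducedPath G a p) (hq : IsInducedPath G b q)
    (h0 : G.Adj (p 0) (q 0)) (h1 : G.Adj (p a) (q b))
    (hpq : ∀ i ≤ a, ∀ j ≤ b, AdjOrEq G (p i) (q j) → (i = 0 ∧ j = 0) ∨ (i = a ∧ j = b)) :
    ∃ c, (∀ i ≤ a, G.Adj c (p i)) ∧ ∀ j ≤ b, G.Adj c (q j) := by
  obtain ⟨c, hc⟩ := hG (a + b + 2) (fun i => if i ≤ a then p i else q (a + 1 + b - i)) (by omega)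
    (by omega) (by
      intro i j hij hj hadj
      by_cases hja : j ≤ a
      · rw [if_pos (by omega), if_pos hja] at hadj
        exact .inl (hp.succ_of_adjOrEq i j hij hja hadj)
      · rw [if_neg hja] at hadj
        by_cases hia : i ≤ a
        · rw [if_pos hia] at hadj
          have := hpq i hia _ (by omega) hadj
          omega
        · rw [if_neg hia] at hadj
          have := hq.succ_of_adjOrEq (a + 1 + b - j) (a + 1 + b - i) (by omega) (by omega)
            hadj.symm
          omega) (by
      intro i hi
      by_cases h3 : i + 1 ≤ a
      · rw [if_pos (by omega), if_pos h3]
        exact hp.adj i (by omega)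
      · rw [if_neg h3]
        by_cases h4 : i ≤ a
        · rw [if_pos h4]
          obtain rfl : i = a := by omega
          rwa [show i + 1 + b - (i + 1) = b by omega]
        · rw [if_neg h4]
          have := (hq.adj (a + 1 + b - (i + 1)) (by omega)).symm
          rwa [show a + 1 + b - (i + 1) + 1 = a + 1 + b - i by omega] at this) (by
      rw [if_pos (by omega), if_neg (by omega), show a + 1 + b - (a + b + 2 - 1) = 0 by omega]
      exact h0)
  refine ⟨c, fun i hi => ?_, fun j hj => ?_⟩
  · have := hc i (by omega)
    simpa [hi] using this
  · have := hc (a + 1 + b - j) (by omega)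
    rwa [if_neg (by omega), show a + 1 + b - (a + 1 + b - j) = j by omega] at this

/-- The path `x, q 0, …, q m, y`. -/
def bracket (x : V) (m : ℕ) (q : ℕ → V) (y : V) : ℕ → V
  | 0 => x
  | j + 1 => if j ≤ m then q j else y

theorem bracket_zero (x : V) (m : ℕ) (q : ℕ → V) (y : V) : bracket x m q y 0 = x := rfl

theorem bracket_mid (x : V) {m : ℕ} (q : ℕ → V) (y : V) {j : ℕ} (hj : j ≤ m) :
    bracket x m q y (j + 1) = q j := by simp [bracket, hj]

theorem bracket_last (x : V) (m : ℕ) (q : ℕ → V) (y : V) : bracket x m q y (m + 2) = y := by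
  simp [bracket]

theorem IsInducedPath.bracket {m : ℕ} {q : ℕ → V} (hq : IsInducedPath G m q) {x y : V}
    (hxy : ¬ AdjOrEq G x y) (hx0 : G.Adj x (q 0)) (hym : G.Adj y (q m))
    (hx : ∀ j ≤ m, AdjOrEq G x (q j) → j = 0) (hy : ∀ j ≤ m, AdjOrEq G y (q j) → j = m) :
    IsInducedPath G (m + 2) (bracket x m q y) := by
  constructor
  · rintro (_ | i) hi
    · rw [bracket_zero, bracket_mid x q y (Nat.zero_le _)]
      exact hx0
    · rw [bracket_mid x q y (by omega)]
      by_cases h1 : i + 1 ≤ m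
      · rw [bracket_mid x q y h1]
        exact hq.adj i (by omega)
      · obtain rfl : i = m := by omega
        rw [bracket_last]
        exact hym.symm
  · rintro i j hij hj hadj
    obtain ⟨j, rfl⟩ : ∃ j', j = j' + 1 := ⟨j - 1, by omega⟩
    rcases i with _ | i
    · rw [bracket_zero] at hadj
      by_cases h1 : j ≤ m
      · rw [bracket_mid x q y h1] at hadj
        have := hx j h1 hadj
        omega
      · obtain rfl : j = m + 1 := by omega
        rw [bracket_last] at hadj
        exact absurd hadj hxy
    · rw [bracket_mid x q y (by omega)] at hadj
      by_cases h1 : j ≤ m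
      · rw [bracket_mid x q y h1] at hadj
        have := hq.succ_of_adjOrEq i j (by omega) h1 hadj
        omega
      · obtain rfl : j = m + 1 := by omega
        rw [bracket_last] at hadj
        have := hy i (by omega) hadj.symm
        omega

theorem bracket_cases (x : V) {m j : ℕ} (q : ℕ → V) (y : V) (hj : j ≤ m + 2) :
    (j = 0 ∧ LocatedComplex.bracket x m q y j = x) ∨
      (∃ i ≤ m, LocatedComplex.bracket x m q y j = q i) ∨
      (j = m + 2 ∧ LocatedComplex.bracket x m q y j = y) := by
  rcases j with _ | j
  · exact .inl ⟨rfl, rfl⟩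
  · by_cases h : j ≤ m
    · exact .inr (.inl ⟨j, h, bracket_mid x q y h⟩)
    · obtain rfl : j = m + 1 := by omega
      exact .inr (.inr ⟨rfl, bracket_last x m q y⟩)

/-- The cycle through `x` and `y` formed by a shortest chain in `S` and a shortest chain in `S'`. -/
theorem Wheeled.bigon (hG : Wheeled G) {S S' : Set V} {i j : ℕ} {x y : V}
    (hS : Joined G S i x y) (hS' : Joined G S' j x y) (hij : i + j ≤ 4)
    (hSS : ∀ s ∈ S, ∀ s' ∈ S', ¬ AdjOrEq G s s') (hxy : ¬ AdjOrEq G x y) :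
    ∃ c, G.Adj c x ∧ G.Adj c y ∧
      (∃ s ∈ S, G.Adj x s ∧ G.Adj c s) ∧ (∃ s ∈ S, G.Adj y s ∧ G.Adj c s) ∧
      (∃ s ∈ S', G.Adj x s ∧ G.Adj c s) ∧ ∃ s ∈ S', G.Adj y s ∧ G.Adj c s := by
  obtain ⟨m, hm, q, hqS, hq, hx0, hym, hx, hy⟩ := hS.exists_induced
  obtain ⟨m', hm', q', hqS', hq', hx0', hym', hx', hy'⟩ := hS'.exists_induced
  have hxS : ∀ s ∈ S, x ≠ s := fun s hs he =>
    hSS s hs _ (hqS' 0 (by omega)) (.inr (he ▸ hx0'))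
  have hyS : ∀ s ∈ S, y ≠ s := fun s hs he =>
    hSS s hs _ (hqS' m' le_rfl) (.inr (he ▸ hym'))
  have hxS' : ∀ s ∈ S', x ≠ s := fun s hs he =>
    hSS _ (hqS 0 (by omega)) s hs (.inr (he ▸ hx0.symm))
  have hyS' : ∀ s ∈ S', y ≠ s := fun s hs he =>
    hSS _ (hqS m le_rfl) s hs (.inr (he ▸ hym.symm))
  have hp := hq.bracket hxy hx0 hym
    (fun j hj h => hx j hj (h.resolve_left (hxS _ (hqS j hj))))
    (fun j hj h => hy j hj (h.resolve_left (hyS _ (hqS j hj))))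
  obtain ⟨c, hc, hc'⟩ := hG.exists_center (by omega) (by omega) (by omega) hp hq'
    (by rwa [bracket_zero]) (by rwa [bracket_last]) (by
      intro k hk l hl hadj
      rcases bracket_cases x q y hk with ⟨h0, he⟩ | ⟨k', hk', he⟩ | ⟨h0, he⟩ <;> rw [he] at hadj
      · exact .inl ⟨h0, hx' l hl (hadj.resolve_left (hxS' _ (hqS' l hl)))⟩
      · exact absurd hadj (hSS _ (hqS k' hk') _ (hqS' l hl))
      · exact .inr ⟨h0, hy' l hl (hadj.resolve_left (hyS' _ (hqS' l hl)))⟩)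
  have hcq : ∀ k ≤ m, G.Adj c (q k) := fun k hk => by
    have := hc (k + 1) (by omega)
    rwa [bracket_mid _ _ _ hk] at this
  refine ⟨c, ?_, ?_, ⟨_, hqS 0 (by omega), hx0, hcq _ (by omega)⟩,
    ⟨_, hqS m le_rfl, hym, hcq _ le_rfl⟩, ⟨_, hqS' 0 (by omega), hx0', hc' _ (by omega)⟩,
    ⟨_, hqS' m' le_rfl, hym', hc' _ le_rfl⟩⟩
  · simpa [bracket_zero] using hc 0 (by omega)
  · simpa [bracket_last] using hc (m + 2) le_rfl

/-- The cycle formed by the edges `a x`, `b y`, a shortest chain in `S` from `a` to `b`, and a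
shortest chain in `S'` from `x` to `y`. -/
theorem Wheeled.rectangle (hG : Wheeled G) {S S' : Set V} {i j : ℕ} {a b x y : V}
    (hax : G.Adj a x) (hby : G.Adj b y)
    (hS : Joined G S i a b) (hS' : Joined G S' j x y) (hij : i + j ≤ 2)
    (hSS : ∀ s ∈ S, ∀ s' ∈ S', ¬ AdjOrEq G s s')
    (hSx : ∀ s ∈ S, ¬ AdjOrEq G s x) (hSy : ∀ s ∈ S, ¬ AdjOrEq G s y)
    (hSa : ∀ s ∈ S', ¬ AdjOrEq G a s) (hSb : ∀ s ∈ S', ¬ AdjOrEq G b s)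
    (hab : ¬ AdjOrEq G a b) (hxy : ¬ AdjOrEq G x y)
    (hay : ¬ AdjOrEq G a y) (hbx : ¬ AdjOrEq G b x) :
    ∃ c, (∃ s ∈ S, G.Adj c s) ∧ ∃ s ∈ S', G.Adj c s := by
  obtain ⟨m, hm, q, hqS, hq, hx0, hym, hx, hy⟩ := hS.exists_induced
  obtain ⟨m', hm', q', hqS', hq', hx0', hym', hx', hy'⟩ := hS'.exists_induced
  have h1 : ∀ s ∈ S, a ≠ s := fun s hs he => hSx s hs (.inr (he ▸ hax))
  have h2 : ∀ s ∈ S, b ≠ s := fun s hs he => hSy s hs (.inr (he ▸ hby))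
  have h3 : ∀ s ∈ S', x ≠ s := fun s hs he => hSa s hs (.inr (he ▸ hax))
  have h4 : ∀ s ∈ S', y ≠ s := fun s hs he => hSb s hs (.inr (he ▸ hby))
  have hp := hq.bracket hab hx0 hym
    (fun j hj h => hx j hj (h.resolve_left (h1 _ (hqS j hj))))
    (fun j hj h => hy j hj (h.resolve_left (h2 _ (hqS j hj))))
  have hp' := hq'.bracket hxy hx0' hym'
    (fun j hj h => hx' j hj (h.resolve_left (h3 _ (hqS' j hj))))
    (fun j hj h => hy' j hj (h.resolve_left (h4 _ (hqS' j hj))))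
  obtain ⟨c, hc, hc'⟩ := hG.exists_center (by omega) (by omega) (by omega) hp hp'
    (by rwa [bracket_zero, bracket_zero]) (by rwa [bracket_last, bracket_last]) (by
      intro k hk l hl hadj
      rcases bracket_cases a q b hk with ⟨h0, he⟩ | ⟨k', hk', he⟩ | ⟨h0, he⟩ <;>
        rcases bracket_cases x q' y hl with ⟨h0', he'⟩ | ⟨l', hl', he'⟩ | ⟨h0', he'⟩ <;>
        rw [he, he'] at hadj
      · exact .inl ⟨h0, h0'⟩
      · exact absurd hadj (hSa _ (hqS' l' hl'))
      · exact absurd hadj hay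
      · exact absurd hadj (hSx _ (hqS k' hk'))
      · exact absurd hadj (hSS _ (hqS k' hk') _ (hqS' l' hl'))
      · exact absurd hadj (hSy _ (hqS k' hk'))
      · exact absurd hadj hbx
      · exact absurd hadj (hSb _ (hqS' l' hl'))
      · exact .inr ⟨h0, h0'⟩)
  refine ⟨c, ⟨_, hqS 0 (by omega), ?_⟩, ⟨_, hqS' 0 (by omega), ?_⟩⟩
  · have := hc 1 (by omega)
    rwa [bracket_mid (j := 0) _ _ _ (by omega)] at this
  · have := hc' 1 (by omega)
    rwa [bracket_mid (j := 0) _ _ _ (by omega)] at this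

end Graph

/-! ### Layered sets with the triangle and vertex conditions in both directions -/

/-- Disjoint layers `J k` of vertices such that `J k` behaves like the set of the vertices at
distance `k` from one end among all vertices on geodesics between two (possibly ideal) endpoints:
the triangle and the vertex condition hold towards either end. -/
structure IsLayering {V : Type*} (G : SimpleGraph V) (J : ℤ → Set V) : Prop where
  eq_of_mem : ∀ {k l x}, x ∈ J k → x ∈ J l → k = l
  le_of_adj : ∀ {k l x y}, x ∈ J k → y ∈ J l → G.Adj x y → k ≤ l + 1
  le_of_common : ∀ {k l x y c}, x ∈ J k → y ∈ J l → G.Adj c x → G.Adj c y → k ≤ l + 2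
  mem_of_adj : ∀ {k x y c}, x ∈ J (k + 1) → y ∈ J (k - 1) → G.Adj c x → G.Adj c y → c ∈ J k
  triangle_down : ∀ {k x y}, x ∈ J k → y ∈ J k → AdjOrEq G x y →
    ∃ t ∈ J (k - 1), G.Adj x t ∧ G.Adj y t
  triangle_up : ∀ {k x y}, x ∈ J k → y ∈ J k → AdjOrEq G x y →
    ∃ t ∈ J (k + 1), G.Adj x t ∧ G.Adj y t
  vertex_down : ∀ {k v x y}, v ∈ J k → x ∈ J (k - 1) → y ∈ J (k - 1) → G.Adj v x → G.Adj v y →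
    ∃ t ∈ J (k - 1), G.Adj v t ∧ AdjOrEq G x t ∧ AdjOrEq G t y
  vertex_up : ∀ {k v x y}, v ∈ J k → x ∈ J (k + 1) → y ∈ J (k + 1) → G.Adj v x → G.Adj v y →
    ∃ t ∈ J (k + 1), G.Adj v t ∧ AdjOrEq G x t ∧ AdjOrEq G t y

namespace IsLayering

variable {V : Type*} {G : SimpleGraph V} {J : ℤ → Set V}

/-- Reversing the order of the layers exchanges the conditions towards the two ends. -/
theorem flip (H : IsLayering G J) : IsLayering G (fun k => J (-k)) where
  eq_of_mem hx hy := by have := H.eq_of_mem hx hy; omega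
  le_of_adj hx hy h := by have := H.le_of_adj hy hx h.symm; omega
  le_of_common hx hy h h' := by have := H.le_of_common hy hx h' h; omega
  mem_of_adj {k x y c} hx hy h h' := by
    rw [show -(k + 1) = -k - 1 by ring] at hx
    rw [show -(k - 1) = -k + 1 by ring] at hy
    exact H.mem_of_adj hy hx h' h
  triangle_down {k x y} hx hy h := by
    rw [show -(k - 1) = -k + 1 by ring]
    exact H.triangle_up hx hy h
  triangle_up {k x y} hx hy h := by
    rw [show -(k + 1) = -k - 1 by ring]
    exact H.triangle_down hx hy h
  vertex_down {k v x y} hv hx hy h h' := by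
    rw [show -(k - 1) = -k + 1 by ring] at *
    exact H.vertex_up hv hx hy h h'
  vertex_up {k v x y} hv hx hy h h' := by
    rw [show -(k + 1) = -k - 1 by ring] at *
    exact H.vertex_down hv hx hy h h'

variable {k : ℤ} {x y x' y' : V}

theorem not_adjOrEq (H : IsLayering G J) {l : ℤ} (hx : x ∈ J k) (hy : y ∈ J l)
    (h : k + 1 < l ∨ l + 1 < k) : ¬ AdjOrEq G x y := by
  rintro (rfl | hadj)
  · have := H.eq_of_mem hx hy
    omega
  · have := H.le_of_adj hx hy hadj
    have := H.le_of_adj hy hx hadj.symm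
    omega

theorem adj_of_adjOrEq (H : IsLayering G J) {l : ℤ} (hx : x ∈ J k) (hy : y ∈ J l)
    (hkl : k ≠ l) (h : AdjOrEq G x y) : G.Adj x y := by
  rcases h with rfl | h
  · exact absurd (H.eq_of_mem hx hy) hkl
  · exact h

/-- An `8`-cycle over four layers has no center; so the rectangle below has a diagonal. -/
theorem rectangle (H : IsLayering G J) (hG : Wheeled G) {i j : ℕ} (hij : i + j ≤ 2)
    (hx' : x' ∈ J k) (hy' : y' ∈ J k) (hx : x ∈ J (k - 1)) (hy : y ∈ J (k - 1))
    (hxx : G.Adj x' x) (hyy : G.Adj y' y) (hup : Joined G (J (k + 1)) i x' y')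
    (hdown : Joined G (J (k - 2)) j x y) :
    AdjOrEq G x' y' ∨ AdjOrEq G x y ∨ G.Adj x' y ∨ G.Adj y' x := by
  by_contra! hcon
  obtain ⟨h1, h2, h3, h4⟩ := hcon
  obtain ⟨c, ⟨s, hs, hcs⟩, ⟨t, ht, hct⟩⟩ := hG.rectangle hxx hyy hup hdown hij
    (fun s hs t ht => H.not_adjOrEq hs ht (by omega))
    (fun s hs => H.not_adjOrEq hs hx (by omega))
    (fun s hs => H.not_adjOrEq hs hy (by omega))
    (fun s hs => H.not_adjOrEq hx' hs (by omega))
    (fun s hs => H.not_adjOrEq hy' hs (by omega)) h1 h2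
    (fun h => h3 (H.adj_of_adjOrEq hx' hy (by omega) h))
    (fun h => h4 (H.adj_of_adjOrEq hy' hx (by omega) h))
  have := H.le_of_common hs ht hcs hct
  omega

theorem joined_two_of_common (H : IsLayering G J) {v : V} (hv : v ∈ J k) (hx : x ∈ J (k - 1))
    (hy : y ∈ J (k - 1)) (hvx : G.Adj v x) (hvy : G.Adj v y) :
    ∃ t ∈ J (k - 1), G.Adj v t ∧ AdjOrEq G x t ∧ AdjOrEq G t y ∧
      Joined G (J (k - 2)) 2 x y := by
  obtain ⟨t, ht, hvt, hxt, hty⟩ := H.vertex_down hv hx hy hvx hvy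
  obtain ⟨p, hp, hxp, htp⟩ := H.triangle_down hx ht hxt
  obtain ⟨q, hq, htq, hyq⟩ := H.triangle_down ht hy hty
  obtain ⟨r, hr, htr, hpr, hrq⟩ := H.vertex_down ht hp hq htp htq
  rw [show k - 1 - 1 = k - 2 by ring] at *
  exact ⟨t, ht, hvt, hxt, hty, joined_two hp hr hq hxp hpr hrq hyq⟩

/-- Let `x, t, y` be consecutive vertices in the lower link of `v`. Vertices `p` below `x, t` and
`q` below `t, y` are equal or adjacent, up to degenerate cases. -/
theorem adjOrEq_of_common (H : IsLayering G J) (hG : Wheeled G) {v t p q : V} (hv : v ∈ J (k + 1))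
    (hx : x ∈ J k) (hy : y ∈ J k) (ht : t ∈ J k) (hp : p ∈ J (k - 1)) (hq : q ∈ J (k - 1))
    (hvx : G.Adj v x) (hvy : G.Adj v y) (hxp : G.Adj x p) (htp : G.Adj t p)
    (htq : G.Adj t q) (hyq : G.Adj y q) :
    AdjOrEq G x y ∨ AdjOrEq G p q ∨ G.Adj x q ∨ G.Adj y p := by
  obtain ⟨_, -, -, -, -, hj⟩ := H.joined_two_of_common ht hp hq htp htq
  exact H.rectangle hG (i := 0) (j := 2) (by omega) hx hy hp hq hxp hyq
    (joined_zero hv hvx.symm hvy.symm) hj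

theorem joined_one_of_common (H : IsLayering G J) (hG : Wheeled G) {v : V} (hv : v ∈ J (k + 1))
    (hx : x ∈ J k) (hy : y ∈ J k) (hvx : G.Adj v x) (hvy : G.Adj v y) :
    Joined G (J (k - 1)) 1 x y := by
  obtain ⟨t, ht, hvt, hxt, hty⟩ := H.vertex_down (k := k + 1) hv (by simpa using hx)
    (by simpa using hy) hvx hvy
  rw [add_sub_cancel_right] at ht
  obtain ⟨p, hp, hxp, htp⟩ := H.triangle_down hx ht hxt
  obtain ⟨q, hq, htq, hyq⟩ := H.triangle_down ht hy hty
  rcases H.adjOrEq_of_common hG hv hx hy ht hp hq hvx hvy hxp htp htq hyq with h | h | h | h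
  · obtain ⟨r, hr, hxr, hyr⟩ := H.triangle_down hx hy h
    exact (joined_zero hr hxr hyr).mono subset_rfl zero_le_one
  · exact joined_one hp hq hxp h hyq
  · exact (joined_zero hq h hyq).mono subset_rfl zero_le_one
  · exact (joined_zero hp hxp h).mono subset_rfl zero_le_one

/-- The vertices `x` and `y` are at distance at most `2` in the layer `J k`. -/
def Close (G : SimpleGraph V) (J : ℤ → Set V) (k : ℤ) (x y : V) : Prop :=
  ∃ c ∈ J k, AdjOrEq G x c ∧ AdjOrEq G c y

/-- An `8`-cycle through `x` and `y` over three layers has a center, which lies in the middle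
layer. -/
theorem close_of_joined (H : IsLayering G J) (hG : Wheeled G) {i j : ℕ} (hij : i + j ≤ 4)
    (hx : x ∈ J k) (hup : Joined G (J (k + 1)) i x y)
    (hdown : Joined G (J (k - 1)) j x y) : Close G J k x y := by
  by_cases hxy : AdjOrEq G x y
  · exact ⟨x, hx, .refl x, hxy⟩
  obtain ⟨c, hcx, hcy, ⟨s, hs, -, hcs⟩, -, ⟨t, ht, -, hct⟩, -⟩ := hG.bigon hup hdown hij
    (fun s hs t ht => H.not_adjOrEq hs ht (by omega)) hxy
  exact ⟨c, H.mem_of_adj hs ht hcs hct, .inr hcx.symm, .inr hcy⟩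

/-- If `x` and `y` have adjacent upper neighbours, they are joined by a short path in the lower
layer. -/
theorem joined_three_of_joined_one (H : IsLayering G J) (hG : Wheeled G) (hx : x ∈ J k)
    (hy : y ∈ J k) (hup : Joined G (J (k + 1)) 1 x y) : Joined G (J (k - 1)) 3 x y := by
  obtain ⟨a, ha, b, hb, hxa, hab, hyb⟩ := hup.exists_of_one
  obtain ⟨z, hz, haz, hbz⟩ := H.triangle_down ha hb hab
  have hx0 := hx
  have hy0 := hy
  have e : J k = J (k + 1 - 1) := by rw [add_sub_cancel_right]
  rw [e] at hx0 hy0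
  obtain ⟨s, hs, has, hxs, hsz⟩ := H.vertex_down ha hx0 hz hxa.symm haz
  obtain ⟨s', hs', hbs', hzs', hsy'⟩ := H.vertex_down hb hz hy0 hbz hyb.symm
  rw [← e] at hz hs hs'
  obtain ⟨f₁, hf₁, hxf₁, hsf₁⟩ := H.triangle_down hx hs hxs
  obtain ⟨f₂, hf₂, hsf₂, hzf₂⟩ := H.triangle_down hs hz hsz
  obtain ⟨f₃, hf₃, hzf₃, hsf₃⟩ := H.triangle_down hz hs' hzs'
  obtain ⟨f₄, hf₄, hsf₄, hyf₄⟩ := H.triangle_down hs' hy hsy'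
  -- A common lower neighbour of `x, z` or of `z, y` leaves room for a detour.
  have hleft : ∀ f ∈ J (k - 1), G.Adj x f → G.Adj z f → Joined G (J (k - 1)) 3 x y := by
    intro f hf hxf hzf
    obtain ⟨p, hp, q, hq, hzp, hpq, hyq⟩ :=
      (H.joined_one_of_common hG hb hz hy hbz hyb.symm).exists_of_one
    obtain ⟨m, hm, -, hfm, hmp⟩ := H.vertex_down hz hf hp hzf hzp
    exact joined_three hf hm hp hq hxf hfm hmp hpq hyq
  have hright : ∀ f ∈ J (k - 1), G.Adj z f → G.Adj y f → Joined G (J (k - 1)) 3 x y := by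
    intro f hf hzf hyf
    obtain ⟨p, hp, q, hq, hxp, hpq, hzq⟩ :=
      (H.joined_one_of_common hG ha hx hz hxa.symm haz).exists_of_one
    obtain ⟨m, hm, -, hqm, hmf⟩ := H.vertex_down hz hq hf hzq hzf
    exact joined_three hp hq hm hf hxp hpq hqm hmf hyf
  have h12 : AdjOrEq G f₁ f₂ ∨ Joined G (J (k - 1)) 3 x y := by
    rcases H.adjOrEq_of_common hG ha hx hz hs hf₁ hf₂ hxa.symm haz hxf₁ hsf₁ hsf₂ hzf₂ with
      h | h | h | h
    · obtain ⟨f, hf, hxf, hzf⟩ := H.triangle_down hx hz h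
      exact .inr (hleft f hf hxf hzf)
    · exact .inl h
    · exact .inr (hleft _ hf₂ h hzf₂)
    · exact .inr (hleft _ hf₁ hxf₁ h)
  rcases h12 with h12 | h12
  swap
  · exact h12
  -- The next step applies to any vertex below `z` and `s'`.
  have h34 : ∀ f ∈ J (k - 1), G.Adj z f → G.Adj s' f →
      AdjOrEq G f f₄ ∨ Joined G (J (k - 1)) 3 x y := by
    intro f hf hzf hsf
    rcases H.adjOrEq_of_common hG hb hz hy hs' hf hf₄ hbz hyb.symm hzf hsf hsf₄ hyf₄ with
      h | h | h | h
    · obtain ⟨f, hf, hzf, hyf⟩ := H.triangle_down hz hy h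
      exact .inr (hright f hf hzf hyf)
    · exact .inl h
    · exact .inr (hright _ hf₄ h hyf₄)
    · exact .inr (hright _ hf hzf h)
  rcases h34 f₃ hf₃ hzf₃ hsf₃ with h34' | h34'
  swap
  · exact h34'
  obtain ⟨m, hm, hzm, h2m, hm3⟩ := H.vertex_down hz hf₂ hf₃ hzf₂ hzf₃
  by_cases hxs' : AdjOrEq G x s'
  · obtain ⟨f, hf, hxf, hsf⟩ := H.triangle_down hx hs' hxs'
    obtain ⟨g, hg, -, hfg, hg4⟩ := H.vertex_down hs' hf hf₄ hsf hsf₄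
    exact (joined_two hf hg hf₄ hxf hfg hg4 hyf₄).mono subset_rfl (by omega)
  have hS' : ∀ t ∈ ({f₁, f₂, m, f₃} : Set V), t ∈ J (k - 1) := by
    rintro t (rfl | rfl | rfl | rfl) <;> assumption
  have hS : ∀ t ∈ ({a, b} : Set V), t ∈ J (k + 1) := by
    rintro t (rfl | rfl) <;> assumption
  obtain ⟨c, hcx, hcs, ⟨u, hu, -, hcu⟩, -, ⟨f, hf, hxf, hcf⟩, ⟨f', hf', hsf', hcf'⟩⟩ :=
    hG.bigon (S := {a, b}) (S' := {f₁, f₂, m, f₃}) (x := x) (y := s') (i := 1) (j := 3)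
      (joined_one (by simp) (by simp) hxa hab hbs'.symm)
      (joined_three (by simp) (by simp) (by simp) (by simp) hxf₁ h12 h2m hm3 hsf₃) (by omega)
      (fun s hs t ht => H.not_adjOrEq (hS s hs) (hS' t ht) (by omega)) hxs'
  have hc : c ∈ J k := H.mem_of_adj (hS u hu) (hS' f hf) hcu hcf
  rcases hf' with rfl | rfl | rfl | rfl
  · obtain ⟨g, hg, -, hfg, hg4⟩ := H.vertex_down hs' hf₁ hf₄ hsf' hsf₄
    exact (joined_two hf₁ hg hf₄ hxf₁ hfg hg4 hyf₄).mono subset_rfl (by omega)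
  · obtain ⟨g, hg, -, hfg, hg4⟩ := H.vertex_down hs' hf₂ hf₄ hsf' hsf₄
    exact joined_three hf₁ hf₂ hg hf₄ hxf₁ h12 hfg hg4 hyf₄
  · rcases h34 _ hm hzm hsf' with h | h
    · exact joined_three hf₁ hf₂ hm hf₄ hxf₁ h12 h2m h hyf₄
    · exact h
  · obtain ⟨g, hg, -, hfg, hg3⟩ := H.vertex_down hc (hS' f hf) hf₃ hcf hcf'
    exact joined_three (hS' f hf) hg hf₃ hf₄ hxf hfg hg3 h34' hyf₄

theorem close_of_joined_one (H : IsLayering G J) (hG : Wheeled G) (hx : x ∈ J k)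
    (hy : y ∈ J k) (hup : Joined G (J (k + 1)) 1 x y) : Close G J k x y :=
  H.close_of_joined hG (by omega) hx hup (H.joined_three_of_joined_one hG hx hy hup)

/-- Vertices with adjacent upper neighbours have adjacent lower neighbours. -/
theorem joined_one_down (H : IsLayering G J) (hG : Wheeled G) (hx : x ∈ J k)
    (hy : y ∈ J k) (hup : Joined G (J (k + 1)) 1 x y) : Joined G (J (k - 1)) 1 x y := by
  obtain ⟨c, hc, hxc, hcy⟩ := H.close_of_joined_one hG hx hy hup
  obtain ⟨p, hp, hxp, hcp⟩ := H.triangle_down hx hc hxc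
  obtain ⟨q, hq, hcq, hyq⟩ := H.triangle_down hc hy hcy
  have hj := H.joined_one_of_common hG (k := k - 1) (by simpa using hc) hp hq hcp hcq
  rw [show k - 1 - 1 = k - 2 by ring] at hj
  rcases H.rectangle hG (by omega) hx hy hp hq hxp hyq hup hj with h | h | h | h
  · obtain ⟨r, hr, hxr, hyr⟩ := H.triangle_down hx hy h
    exact (joined_zero hr hxr hyr).mono subset_rfl zero_le_one
  · exact joined_one hp hq hxp h hyq
  · exact (joined_zero hq h hyq).mono subset_rfl zero_le_one
  · exact (joined_zero hp hxp h).mono subset_rfl zero_le_one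

theorem joined_one_up (H : IsLayering G J) (hG : Wheeled G) (hx : x ∈ J k)
    (hy : y ∈ J k) (hdown : Joined G (J (k - 1)) 1 x y) : Joined G (J (k + 1)) 1 x y := by
  have := H.flip.joined_one_down hG (k := -k) (x := x) (y := y) (by simpa using hx)
    (by simpa using hy) (by
      rwa [show -(-k + 1) = k - 1 by ring])
  rwa [show -(-k - 1) = k + 1 by ring] at this

/-- Let `x` and `p` lie below `x'`. Unless they have a common lower neighbour, there are adjacent
`f` below `x` and `g` below `p` such that `f` is even adjacent to the neighbours of `g` below `p`.
-/
theorem exists_below_of_common (H : IsLayering G J) (hG : Wheeled G) {p : V}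
    (hx' : x' ∈ J (k + 1)) (hx : x ∈ J k) (hp : p ∈ J k) (hxx : G.Adj x' x) (hxp : G.Adj x' p) :
    (∃ f ∈ J (k - 1), G.Adj x f ∧ G.Adj p f) ∨
      ∃ f ∈ J (k - 1), ∃ g ∈ J (k - 1), G.Adj x f ∧ G.Adj p g ∧
        ∀ m ∈ J (k - 1), G.Adj p m → AdjOrEq G g m → AdjOrEq G f m := by
  obtain ⟨f, hf, g, hg, hxf, hfg, hpg⟩ :=
    (H.joined_one_of_common hG hx' hx hp hxx hxp).exists_of_one
  by_cases hcom : ∃ f ∈ J (k - 1), G.Adj x f ∧ G.Adj p f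
  · exact .inl hcom
  refine .inr ⟨f, hf, g, hg, hxf, hpg, fun m hm hpm hgm => ?_⟩
  obtain ⟨l₁, hl₁, hfl, hgl⟩ := H.triangle_down hf hg hfg
  obtain ⟨l₂, hl₂, hgl', hml⟩ := H.triangle_down hg hm hgm
  obtain ⟨l, hl, -, h1, h2⟩ := H.vertex_down hg hl₁ hl₂ hgl hgl'
  have hj : Joined G (J (k - 1 - 1)) 2 f m := joined_two hl₁ hl hl₂ hfl h1 h2 hml
  rw [show k - 1 - 1 = k - 2 by ring] at hj
  rcases H.rectangle hG (by omega) hx hp hf hm hxf hpm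
    (joined_zero hx' hxx.symm hxp.symm) hj with h | h | h | h
  · exact absurd (H.triangle_down hx hp h) hcom
  · exact h
  · exact absurd ⟨m, hm, h, hpm⟩ hcom
  · exact absurd ⟨f, hf, hxf, h⟩ hcom

/-- Lower neighbours `x` of `x'` and `y` of `y'` are close if `x'` and `y'` are close and have a
common lower neighbour. -/
theorem close_of_common_below (H : IsLayering G J) (hG : Wheeled G) {p c : V}
    (hx' : x' ∈ J (k + 1)) (hy' : y' ∈ J (k + 1)) (hc : c ∈ J (k + 1))
    (hx : x ∈ J k) (hy : y ∈ J k) (hp : p ∈ J k) (hxx : G.Adj x' x) (hyy : G.Adj y' y)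
    (hxp : G.Adj x' p) (hyp : G.Adj y' p) (hxc : AdjOrEq G x' c) (hcy : AdjOrEq G c y') :
    Close G J k x y := by
  refine H.close_of_joined hG (i := 2) (j := 2) (by omega) hx
    (joined_two hx' hc hy' hxx.symm hxc hcy hyy.symm) ?_
  rcases H.exists_below_of_common hG hx' hx hp hxx hxp with
      ⟨f, hf, hxf, hpf⟩ | ⟨f, hf, g, hg, hxf, hpg, hfg⟩ <;>
    rcases H.exists_below_of_common hG hy' hy hp hyy hyp with
      ⟨f', hf', hyf, hpf'⟩ | ⟨f', hf', g', hg', hyf, hpg', hfg'⟩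
  · obtain ⟨m, hm, hpm, h1, h2⟩ := H.vertex_down hp hf hf' hpf hpf'
    exact joined_two hf hm hf' hxf h1 h2 hyf
  · obtain ⟨m, hm, hpm, h1, h2⟩ := H.vertex_down hp hf hg' hpf hpg'
    exact joined_two hf hm hf' hxf h1 (hfg' m hm hpm h2.symm).symm hyf
  · obtain ⟨m, hm, hpm, h1, h2⟩ := H.vertex_down hp hg hf' hpg hpf'
    exact joined_two hf hm hf' hxf (hfg m hm hpm h1) h2 hyf
  · obtain ⟨m, hm, hpm, h1, h2⟩ := H.vertex_down hp hg hg' hpg hpg'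
    exact joined_two hf hm hf' hxf (hfg m hm hpm h1) (hfg' m hm hpm h2.symm).symm hyf

/-- Lower neighbours of close vertices with adjacent upper neighbours are close. -/
theorem close_below_of_joined_one (H : IsLayering G J) (hG : Wheeled G) {c : V}
    (hx' : x' ∈ J (k + 1)) (hy' : y' ∈ J (k + 1)) (hc : c ∈ J (k + 1))
    (hxc : AdjOrEq G x' c) (hcy : AdjOrEq G c y') (hup : Joined G (J (k + 2)) 1 x' y')
    (hx : x ∈ J k) (hy : y ∈ J k) (hxx : G.Adj x' x) (hyy : G.Adj y' y) :
    Close G J k x y := by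
  have e : J k = J (k + 1 - 1) := by rw [add_sub_cancel_right]
  have e1 : J (k - 1) = J (k + 1 - 2) := by rw [show k + 1 - 2 = k - 1 by ring]
  have e2 : J (k + 2) = J (k + 1 + 1) := by rw [show k + 1 + 1 = k + 2 by ring]
  by_cases hxy' : AdjOrEq G x' y'
  · exact H.close_of_joined_one hG hx hy (joined_one hx' hy' hxx.symm hxy' hyy.symm)
  have hdown : ∀ b ∈ J k, G.Adj c b → Joined G (J (k - 1)) 1 x b := fun b hb hcb =>
    H.joined_one_down hG hx hb (joined_one hx' hc hxx.symm hxc hcb.symm)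
  by_cases hcx : G.Adj c x
  · exact H.close_of_joined_one hG hx hy (joined_one hc hy' hcx.symm hcy hyy.symm)
  by_cases hyx : G.Adj y' x
  · exact H.close_of_joined_one hG hx hy
      ((joined_zero hy' hyx.symm hyy.symm).mono subset_rfl zero_le_one)
  -- The cycle `x', …, y', b, …, x` spans four layers, so it has a chord.
  have hchord : ∀ b ∈ J k, G.Adj c b → G.Adj y' b → G.Adj x' b ∨ AdjOrEq G x b := by
    intro b hb hcb hyb
    rcases H.rectangle (k := k + 1) hG (i := 1) (j := 1) (by omega) hx' hy' (e ▸ hx) (e ▸ hb)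
      hxx hyb (e2 ▸ hup) (e1 ▸ hdown b hb hcb) with h | h | h | h
    · exact absurd h hxy'
    · exact .inr h
    · exact .inl h
    · exact absurd h hyx
  have hfinish : ∀ b ∈ J k, G.Adj x' b → G.Adj y' b → Close G J k x y := fun b hb h h' =>
    H.close_of_common_below hG hx' hy' hc hx hy hb hxx hyy h h' hxc hcy
  obtain ⟨b, hb, hcb, hyb⟩ := H.triangle_down hc hy' hcy
  rw [← e] at hb
  rcases hchord b hb hcb hyb with hxb | hxb
  · exact hfinish b hb hxb hyb
  obtain ⟨s, hs, hys, hbs, hsy⟩ := H.vertex_down hy' (e ▸ hb) (e ▸ hy) hyb hyy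
  rw [← e] at hs
  by_cases hxs : AdjOrEq G x s
  · exact ⟨s, hs, hxs, hsy⟩
  by_cases hcs : G.Adj c s
  · rcases hchord s hs hcs hys with h | h
    · exact hfinish s hs h hys
    · exact ⟨s, hs, h, hsy⟩
  by_cases hxs' : G.Adj x' s
  · exact hfinish s hs hxs' hys
  obtain ⟨f, hf, hxf, hbf⟩ := H.triangle_down hx hb hxb
  obtain ⟨g, hg, hbg, hsg⟩ := H.triangle_down hb hs hbs
  obtain ⟨m, hm, -, hfm, hmg⟩ := H.vertex_down hb hf hg hbf hbg
  have hS : ∀ t ∈ ({x', c, y'} : Set V), t ∈ J (k + 1) := by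
    rintro t (rfl | rfl | rfl) <;> assumption
  obtain ⟨d, hdx, hds, ⟨u, hu, hxu, hdu⟩, ⟨v, hv, hsv, hdv⟩, ⟨w, hw, -, hdw⟩, -⟩ :=
    hG.bigon (S := {x', c, y'}) (S' := J (k - 1)) (x := x) (y := s) (i := 2) (j := 2)
      (joined_two (by simp) (by simp) (by simp) hxx.symm hxc hcy hys.symm)
      (joined_two hf hm hg hxf hfm hmg hsg) (by omega)
      (fun s hs t ht => H.not_adjOrEq (hS s hs) ht (by omega)) hxs
  have hd : d ∈ J k := H.mem_of_adj (hS u hu) hw hdu hdw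
  have hu' : u = x' := by
    rcases hu with rfl | rfl | rfl
    · rfl
    · exact absurd hxu.symm hcx
    · exact absurd hxu.symm hyx
  have hv' : v = y' := by
    rcases hv with rfl | rfl | rfl
    · exact absurd hsv.symm hxs'
    · exact absurd hsv.symm hcs
    · rfl
  subst hu' hv'
  exact hfinish d hd hdu.symm hdv.symm

/-- If close vertices do not have adjacent lower neighbours, then their lower neighbours do have
adjacent upper neighbours. -/
theorem close_below_of_not_joined_one (H : IsLayering G J) (hG : Wheeled G) {c : V}
    (hx' : x' ∈ J (k + 1)) (hy' : y' ∈ J (k + 1)) (hc : c ∈ J (k + 1))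
    (hxc : AdjOrEq G x' c) (hcy : AdjOrEq G c y') (hdown : ¬ Joined G (J k) 1 x' y')
    (hx : x ∈ J k) (hy : y ∈ J k) (hxx : G.Adj x' x) (hyy : G.Adj y' y) :
    Close G J k x y := by
  have e : J k = J (k + 1 - 1) := by rw [add_sub_cancel_right]
  by_cases hcx : G.Adj c x
  · exact H.close_of_joined_one hG hx hy (joined_one hc hy' hcx.symm hcy hyy.symm)
  obtain ⟨b, hb, hcb, hyb⟩ := H.triangle_down hc hy' hcy
  rw [← e] at hb
  by_cases hxb : AdjOrEq G x b
  · exact absurd (joined_one hx hb hxx hxb hyb) hdown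
  have hS : ∀ t ∈ ({x', c} : Set V), t ∈ J (k + 1) := by
    rintro t (rfl | rfl) <;> assumption
  have hj : Joined G ({x', c} : Set V) 1 x b :=
    joined_one (by simp) (by simp) hxx.symm hxc hcb.symm
  obtain ⟨d, hdx, hdb, ⟨u, hu, hxu, hdu⟩, -, ⟨w, hw, -, hdw⟩, -⟩ :=
    hG.bigon hj (H.joined_one_down hG hx hb (hj.mono hS le_rfl)) (by omega)
      (fun s hs t ht => H.not_adjOrEq (hS s hs) ht (by omega)) hxb
  have hd : d ∈ J k := H.mem_of_adj (hS u hu) hw hdu hdw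
  rcases hu with rfl | rfl
  · exact absurd (joined_one hd hb hdu.symm (.inr hdb) hyb) hdown
  · exact absurd hxu.symm hcx

/-- Closeness is inherited by lower neighbours. -/
theorem close_below (H : IsLayering G J) (hG : Wheeled G) (hx' : x' ∈ J (k + 1))
    (hy' : y' ∈ J (k + 1)) (hclose : Close G J (k + 1) x' y')
    (hx : x ∈ J k) (hy : y ∈ J k) (hxx : G.Adj x' x) (hyy : G.Adj y' y) :
    Close G J k x y := by
  obtain ⟨c, hc, hxc, hcy⟩ := hclose
  by_cases hdown : Joined G (J k) 1 x' y'
  · have e : J k = J (k + 1 - 1) := by rw [add_sub_cancel_right]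
    have hup := H.joined_one_up hG hx' hy' (e ▸ hdown)
    rw [show k + 1 + 1 = k + 2 by ring] at hup
    exact H.close_below_of_joined_one hG hx' hy' hc hxc hcy hup hx hy hxx hyy
  · exact H.close_below_of_not_joined_one hG hx' hy' hc hxc hcy hdown hx hy hxx hyy

end IsLayering

/-! ### The property `SD'` implies simple connectedness -/

section Complex

variable {V : Type*} {K : AbstractSimplicialComplex V}

theorem skel_adj_of_mem_face {s : Finset V} (hs : s ∈ K.faces) {x y : V} (hx : x ∈ s) (hy : y ∈ s)
    (hxy : x ≠ y) : (skel K).Adj x y := by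
  classical
  refine ⟨hxy, {x, y}, (K.isRelLowerSet_faces hs).2 ?_ (by simp), by simp⟩
  intro z hz
  simp only [Finset.mem_insert, Finset.mem_singleton] at hz
  rcases hz with rfl | rfl <;> assumption

theorem adj_of_mem_link {σ : Finset V} {t x : V} (ht : {t} ∈ link K σ) (hx : x ∈ σ) :
    (skel K).Adj x t := by
  obtain ⟨-, hdisj, s, hs, hcoe⟩ := ht
  refine skel_adj_of_mem_face hs (?_ : x ∈ (s : Set V)) (?_ : t ∈ (s : Set V)) ?_
  · rw [hcoe]
    exact .inl hx
  · rw [hcoe]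
    exact .inr (by simp)
  · rintro rfl
    simp [hx] at hdisj

theorem mem_link_singleton (hflag : IsFlag K) {v t : V} (h : (skel K).Adj v t) :
    {t} ∈ link K {v} := by
  classical
  refine ⟨hflag {t} (by simp) (by simp), by simpa using h.1, ?_⟩
  have := h.2
  simpa [Set.pair_comm] using this

theorem adjOrEq_of_near {x y : V} (h : Near K x y) : AdjOrEq (skel K) x y := by
  by_cases hxy : x = y
  · exact .inl hxy
  · exact .inr ⟨hxy, h⟩

theorem isSimplex_triangle (hflag : IsFlag K) {x y z : V} (hxy : (skel K).Adj x y)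
    (hyz : (skel K).Adj y z) (hxz : (skel K).Adj x z) : IsSimplex K {x, y, z} := by
  classical
  refine ⟨{x, y, z}, hflag _ (by simp) ?_, by simp⟩
  intro v hv w hw hvw
  simp only [Finset.mem_insert, Finset.mem_singleton] at hv hw
  rcases hv with rfl | rfl | rfl <;> rcases hw with rfl | rfl | rfl <;>
    first
    | exact absurd rfl hvw
    | assumption
    | exact hxy.symm
    | exact hyz.symm
    | exact hxz.symm

theorem dist_le_add_one_of_adj {G : SimpleGraph V} (hconn : G.Connected) (O : V) {x y : V}
    (h : G.Adj x y) : G.dist O x ≤ G.dist O y + 1 := by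
  have h1 := hconn.dist_triangle (u := O) (v := y) (w := x)
  have h2 : G.dist y x = 1 := SimpleGraph.dist_eq_one_iff_adj.2 h.symm
  omega

theorem exists_adj_dist_eq {G : SimpleGraph V} (hconn : G.Connected) {O x : V} {i : ℕ}
    (hx : G.dist O x = i + 1) : ∃ t, G.Adj x t ∧ G.dist O t = i := by
  obtain ⟨p, hp⟩ := hconn.exists_walk_length_eq_dist x O
  rw [SimpleGraph.dist_comm, hx] at hp
  cases p with
  | nil => simp at hp
  | @cons _ t _ h p =>
    refine ⟨t, h, ?_⟩
    have h1 := SimpleGraph.dist_le p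
    have h2 := dist_le_add_one_of_adj hconn O h
    rw [SimpleGraph.Walk.length_cons] at hp
    rw [SimpleGraph.dist_comm] at h1
    omega

/-- The triangle condition, including the trivial case of the sphere of radius `1`. -/
theorem SatisfiesSD.exists_triangle (hSD : SatisfiesSD K) (hconn : (skel K).Connected) {O x y : V}
    {i : ℕ} (hx : (skel K).dist O x = i + 1) (hy : (skel K).dist O y = i + 1)
    (hxy : (skel K).Adj x y) :
    ∃ t, (skel K).Adj x t ∧ (skel K).Adj y t ∧ (skel K).dist O t = i := by
  classical
  rcases Nat.eq_zero_or_pos i with rfl | hi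
  · exact ⟨O, (SimpleGraph.dist_eq_one_iff_adj.1 hx).symm,
      (SimpleGraph.dist_eq_one_iff_adj.1 hy).symm, SimpleGraph.dist_self⟩
  · obtain ⟨s, hs, hcoe⟩ := hxy.2
    have hmem : ∀ z, z ∈ s ↔ z = x ∨ z = y := fun z => by
      rw [← Finset.mem_coe, hcoe]
      simp
    have hs2 : s = {x, y} := by
      ext z
      simp [hmem]
    obtain ⟨t, ht, htl⟩ := (hSD.2 i O i (by simp; omega)).1 s hs
      (by rw [hs2, Finset.card_pair hxy.1]) (by
        intro z hz
        rcases (hmem z).1 hz with rfl | rfl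
        · exact hx
        · exact hy)
    have htx := adj_of_mem_link htl ((hmem x).2 (.inl rfl))
    have hty := adj_of_mem_link htl ((hmem y).2 (.inr rfl))
    refine ⟨t, htx, hty, ?_⟩
    have h1 := dist_le_add_one_of_adj hconn O htx
    have h2 : (skel K).dist O t ≤ i := ht
    omega

/-- The vertex condition, including the trivial case of the sphere of radius `1`. -/
theorem SatisfiesSD.exists_vertex (hSD : SatisfiesSD K) (hconn : (skel K).Connected) {O v x y : V}
    {i : ℕ} (hv : (skel K).dist O v = i + 1) (hx : (skel K).dist O x = i)
    (hy : (skel K).dist O y = i) (hvx : (skel K).Adj v x) (hvy : (skel K).Adj v y) :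
    ∃ t, (skel K).Adj v t ∧ AdjOrEq (skel K) x t ∧ AdjOrEq (skel K) t y ∧
      (skel K).dist O t = i := by
  rcases Nat.eq_zero_or_pos i with rfl | hi
  · rw [hconn.dist_eq_zero_iff] at hx hy
    subst hx
    exact ⟨O, hvx, .inl rfl, .inl hy, SimpleGraph.dist_self⟩
  · obtain ⟨t, ht, htl, h1, h2⟩ := (hSD.2 i O i (by simp; omega)).2 v hv x hx.le y hy.le
      (mem_link_singleton hSD.1 hvx) (mem_link_singleton hSD.1 hvy)
    have hvt := adj_of_mem_link htl (by simp : v ∈ ({v} : Finset V))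
    refine ⟨t, hvt, (adjOrEq_of_near h1).symm, adjOrEq_of_near h2, ?_⟩
    have h3 := dist_le_add_one_of_adj hconn O hvt
    have h4 : (skel K).dist O t ≤ i := ht
    omega

theorem exists_geodesic {G : SimpleGraph V} (hconn : G.Connected) {O x : V} {i : ℕ}
    (hx : G.dist O x = i) : ∃ p : G.Walk x O, p.length = i := by
  obtain ⟨p, hp⟩ := hconn.exists_walk_length_eq_dist x O
  exact ⟨p, by rw [hp, SimpleGraph.dist_comm, hx]⟩

/-- Two edge paths that start with two sides of a triangle and go on to a common vertex. -/
theorem edgeHomotopic_cons_cons (hflag : IsFlag K) {u x y s O : V} (hux : (skel K).Adj u x)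
    (huy : (skel K).Adj u y) (hxy : (skel K).Adj x y) (hxs : (skel K).Adj x s)
    (hys : (skel K).Adj y s) (p : (skel K).Walk s O) :
    EdgeHomotopic K (.cons hux (.cons hxs p)) (.cons huy (.cons hys p)) :=
  .trans (.cons hux (.symm (.triangle hxy hys hxs (isSimplex_triangle hflag hxy hys hxs) p)))
    (.triangle hux hxy huy (isSimplex_triangle hflag hux hxy huy) _)

/-- Geodesics with the same endpoints are homotopic, by induction on their length: (V) reduces to
the case that their first steps end in equal or adjacent vertices, and (T) fills the triangle. -/
theorem SatisfiesSD.edgeHomotopic_of_geodesic (hSD : SatisfiesSD K) (hconn : (skel K).Connected)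
    {O : V} (i : ℕ) {u : V} (hu : (skel K).dist O u = i) (p q : (skel K).Walk u O)
    (hp : p.length = i) (hq : q.length = i) : EdgeHomotopic K p q := by
  induction i generalizing u with
  | zero =>
    rw [hconn.dist_eq_zero_iff] at hu
    subst hu
    rw [SimpleGraph.Walk.eq_nil_iff_nil.2 (SimpleGraph.Walk.length_eq_zero_iff.1 hp),
      SimpleGraph.Walk.eq_nil_iff_nil.2 (SimpleGraph.Walk.length_eq_zero_iff.1 hq)]
    exact .refl _
  | succ i ih =>
    have hstep : ∀ {x y : V} (hux : (skel K).Adj u x) (huy : (skel K).Adj u y)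
        (p : (skel K).Walk x O) (q : (skel K).Walk y O), AdjOrEq (skel K) x y →
        (skel K).dist O x = i → (skel K).dist O y = i → p.length = i → q.length = i →
        EdgeHomotopic K (.cons hux p) (.cons huy q) := by
      rintro x y hux huy p q (rfl | hxy) hx hy hp hq
      · exact .cons hux (ih hx p q hp hq)
      · obtain ⟨j, rfl⟩ : ∃ j, i = j + 1 := by
          refine ⟨i - 1, ?_⟩
          rcases Nat.eq_zero_or_pos i with rfl | hi
          · rw [hconn.dist_eq_zero_iff] at hx hy
            exact absurd (hx.symm.trans hy) hxy.1
          · omega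
        obtain ⟨s, hxs, hys, hs⟩ := hSD.exists_triangle hconn hx hy hxy
        obtain ⟨g, hg⟩ := exists_geodesic hconn hs
        refine .trans (.cons hux (ih hx p (.cons hxs g) hp (by simp [hg]))) (.trans
          (edgeHomotopic_cons_cons hSD.1 hux huy hxy hxs hys g)
          (.cons huy (ih hy (.cons hys g) q (by simp [hg]) hq)))
    have hlow : ∀ {x : V}, (skel K).Adj u x → ∀ p : (skel K).Walk x O, p.length = i →
        (skel K).dist O x = i := by
      intro x hux p hp
      have h1 := dist_le_add_one_of_adj hconn O hux
      have h2 := SimpleGraph.dist_le p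
      rw [SimpleGraph.dist_comm] at h2
      omega
    cases p with
    | nil => simp at hp
    | @cons _ x _ hux p =>
      cases q with
      | nil => simp at hq
      | @cons _ y _ huy q =>
        rw [SimpleGraph.Walk.length_cons, Nat.add_right_cancel_iff] at hp hq
        have hx := hlow hux p hp
        have hy := hlow huy q hq
        obtain ⟨t, hut, hxt, hty, ht⟩ := hSD.exists_vertex hconn hu hx hy hux huy
        obtain ⟨g, hg⟩ := exists_geodesic hconn ht
        exact .trans (hstep hux hut p g hxt hx ht hp hg) (hstep hut huy g q hty ht hy hg hq)

/-- Every edge path is homotopic to any geodesic with the same endpoints. -/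
theorem SatisfiesSD.edgeHomotopic_geodesic (hSD : SatisfiesSD K) (hconn : (skel K).Connected)
    {O u : V} (p g : (skel K).Walk u O) (hg : g.length = (skel K).dist O u) :
    EdgeHomotopic K p g := by
  induction p with
  | nil =>
    rw [SimpleGraph.dist_self] at hg
    rw [SimpleGraph.Walk.eq_nil_iff_nil.2 (SimpleGraph.Walk.length_eq_zero_iff.1 hg)]
    exact .refl _
  | @cons u w O h p ih =>
    obtain ⟨g', hg'⟩ := exists_geodesic hconn (O := O) (x := w) rfl
    refine .trans (.cons h (ih g' hg')) ?_
    have h1 := dist_le_add_one_of_adj hconn O h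
    have h2 := dist_le_add_one_of_adj hconn O h.symm
    obtain h3 | h3 | h3 : (skel K).dist O u = (skel K).dist O w + 1 ∨
        (skel K).dist O w = (skel K).dist O u + 1 ∨
        (skel K).dist O u = (skel K).dist O w := by omega
    · exact hSD.edgeHomotopic_of_geodesic hconn _ h3 _ _ (by simp [hg']) (by rw [hg, h3])
    · exact .trans (.cons h (hSD.edgeHomotopic_of_geodesic hconn _ h3 g' (.cons h.symm g)
        (by rw [hg', h3]) (by simp [hg]))) (.backtrack h g)
    · obtain ⟨i, hi⟩ : ∃ i, (skel K).dist O w = i + 1 := by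
        refine ⟨(skel K).dist O w - 1, ?_⟩
        have : (skel K).dist O w ≠ 0 := by
          intro h0
          have h4 := h0
          rw [← h3, hconn.dist_eq_zero_iff] at h4
          rw [hconn.dist_eq_zero_iff] at h0
          exact h.1 (h4.symm.trans h0)
        omega
      obtain ⟨s, hus, hws, hs⟩ := hSD.exists_triangle hconn (h3.trans hi) hi h
      obtain ⟨r, hr⟩ := exists_geodesic hconn hs
      exact .trans (.cons h (hSD.edgeHomotopic_of_geodesic hconn _ hi g' (.cons hws r)
        (by rw [hg', hi]) (by simp [hr]))) (.trans
        (.triangle h hws hus (isSimplex_triangle hSD.1 h hws hus) r)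
        (hSD.edgeHomotopic_of_geodesic hconn _ (h3.trans hi) (.cons hus r) g
          (by simp [hr]) (by rw [hg, h3, hi])))

theorem SatisfiesSD.isHomotopicallyTrivial (hSD : SatisfiesSD K) (hconn : (skel K).Connected)
    {v : V} (p : (skel K).Walk v v) : IsHomotopicallyTrivial K p :=
  hSD.edgeHomotopic_geodesic hconn p .nil (by simp)

/-! ### Located complexes with the property `SD'` are wheeled -/

theorem exists_walk_of_adj {G : SimpleGraph V} (f : ℕ → V) (n : ℕ)
    (hf : ∀ i < n, G.Adj (f i) (f (i + 1))) :
    ∃ p : G.Walk (f 0) (f n), p.length = n ∧ p.support = (List.range (n + 1)).map f ∧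
      ∀ e, e ∈ p.edges ↔ ∃ i < n, e = s(f i, f (i + 1)) := by
  induction n with
  | zero => exact ⟨.nil, by simp⟩
  | succ n ih =>
    obtain ⟨p, hp, hs, he⟩ := ih fun i hi => hf i (by omega)
    refine ⟨p.concat (hf n (by omega)), by simp [hp], ?_, fun e => ?_⟩
    · rw [SimpleGraph.Walk.support_concat, hs, List.range_succ (n := n + 1), List.map_append]
      simp
    · rw [SimpleGraph.Walk.edges_concat, List.concat_eq_append, List.mem_append, he,
        List.mem_singleton]
      constructor
      · rintro (⟨i, hi, rfl⟩ | rfl)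
        · exact ⟨i, by omega, rfl⟩
        · exact ⟨n, by omega, rfl⟩
      · rintro ⟨i, hi, rfl⟩
        by_cases h : i < n
        · exact .inl ⟨i, h, rfl⟩
        · obtain rfl : i = n := by omega
          exact .inr rfl

theorem wheeled_skel (hconn : (skel K).Connected) (hloc : IsLocated K 8) (hSD : SatisfiesSD K) :
    Wheeled (skel K) := by
  intro n f h4 h8 hind hadj hclose
  obtain ⟨m, rfl⟩ : ∃ m, n = m + 1 := ⟨n - 1, by omega⟩
  rw [Nat.add_sub_cancel] at hclose
  have hne : ∀ i j, i < j → j < m + 1 → f i ≠ f j := by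
    intro i j hij hj he
    rcases hind i j hij hj (.inl he) with rfl | ⟨rfl, h⟩
    · exact (hadj i hj).1 he
    · obtain rfl : j = m := by omega
      exact hclose.1 he
  obtain ⟨p, hp, hps, hpe⟩ := exists_walk_of_adj f m fun i hi => hadj i (by omega)
  have hmem : ∀ x, x ∈ (SimpleGraph.Walk.cons hclose.symm p).support ↔ ∃ i < m + 1, x = f i := by
    intro x
    rw [SimpleGraph.Walk.support_cons, List.mem_cons, hps, List.mem_map]
    constructor
    · rintro (rfl | ⟨i, hi, rfl⟩)
      · exact ⟨m, by omega, rfl⟩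
      · exact ⟨i, List.mem_range.1 hi, rfl⟩
    · rintro ⟨i, hi, rfl⟩
      exact .inr ⟨i, List.mem_range.2 hi, rfl⟩
  have hcycle : (SimpleGraph.Walk.cons hclose.symm p).IsCycle := by
    rw [SimpleGraph.Walk.cons_isCycle_iff, SimpleGraph.Walk.isPath_def, hps, hpe]
    constructor
    · refine List.Nodup.map_on ?_ List.nodup_range
      intro i hi j hj hij
      rw [List.mem_range] at hi hj
      rcases lt_trichotomy i j with h | h | h
      · exact absurd hij (hne i j h hj)
      · exact h
      · exact absurd hij.symm (hne j i h hi)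
    · rintro ⟨i, hi, he⟩
      have hm0 : f m ≠ f i := (hne i m hi (by omega)).symm
      rcases Sym2.eq_iff.1 he with ⟨h1, -⟩ | ⟨h1, h2⟩
      · exact hm0 h1
      · rcases Nat.eq_zero_or_pos i with rfl | hi0
        · exact hne 1 m (by omega) (by omega) h1.symm
        · exact hne 0 i hi0 (by omega) h2
  have hfull : IsFullCycle K (SimpleGraph.Walk.cons hclose.symm p) := by
    refine ⟨hcycle, fun s hs hsub => ?_⟩
    obtain ⟨x, hx⟩ := (K.isRelLowerSet_faces hs).1
    by_cases hone : ∃ x, s = {x}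
    · exact .inl hone
    right
    have hidx : ∀ i j, i < j → j < m + 1 → f i ∈ s → f j ∈ s → j = i + 1 ∨ (i = 0 ∧ j = m) := by
      intro i j hij hj hi' hj'
      have := hind i j hij hj (.inr (skel_adj_of_mem_face hs hi' hj' (hne i j hij hj)))
      omega
    obtain ⟨i, j, hij, hj, hi', hj'⟩ : ∃ i j, i < j ∧ j < m + 1 ∧ f i ∈ s ∧ f j ∈ s := by
      obtain ⟨y, hy, hxy⟩ : ∃ y ∈ s, y ≠ x := by
        by_contra! hcon
        exact hone ⟨x, Finset.eq_singleton_iff_unique_mem.2 ⟨hx, hcon⟩⟩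
      obtain ⟨i, hi, rfl⟩ := (hmem x).1 (hsub x hx)
      obtain ⟨j, hj, rfl⟩ := (hmem y).1 (hsub y hy)
      rcases lt_trichotomy i j with h | rfl | h
      · exact ⟨i, j, h, hj, hx, hy⟩
      · exact absurd rfl hxy
      · exact ⟨j, i, h, hi, hy, hx⟩
    refine ⟨s(f i, f j), ?_, fun z => ?_⟩
    · rw [SimpleGraph.Walk.edges_cons, List.mem_cons, hpe]
      rcases hidx i j hij hj hi' hj' with rfl | ⟨rfl, rfl⟩
      · exact .inr ⟨i, by omega, rfl⟩
      · exact .inl Sym2.eq_swap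
    · rw [Sym2.mem_iff]
      constructor
      · intro hz
        obtain ⟨l, hl, rfl⟩ := (hmem z).1 (hsub z hz)
        have h1 := hidx i j hij hj hi' hj'
        rcases lt_trichotomy l i with h | rfl | h
        · have h2 := hidx l i h (by omega) hz hi'
          have h3 := hidx l j (by omega) hj hz hj'
          omega
        · exact .inl rfl
        · have h2 := hidx i l h hl hi' hz
          rcases lt_trichotomy l j with h' | rfl | h'
          · have h3 := hidx l j h' hj hz hj'
            omega
          · exact .inr rfl
          · have h3 := hidx j l h' hl hj' hz
            omega
      · rintro (rfl | rfl) <;> assumption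
  obtain ⟨c, hc⟩ := hloc.2 _ _ hfull (hSD.isHomotopicallyTrivial hconn _) (by
    rw [SimpleGraph.Walk.length_cons, hp]
    omega)
  have hc' : ∀ i < m + 1, AdjOrEq (skel K) c (f i) := by
    intro i hi
    have h1 : (skel K).dist c (f i) ≤ 1 := hc (f i) ((hmem _).2 ⟨i, hi, rfl⟩)
    obtain h2 | h2 : (skel K).dist c (f i) = 0 ∨ (skel K).dist c (f i) = 1 := by omega
    · exact .inl (hconn.dist_eq_zero_iff.1 h2)
    · exact .inr (SimpleGraph.dist_eq_one_iff_adj.1 h2)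
  refine ⟨c, fun i hi => (hc' i hi).resolve_left ?_⟩
  -- A vertex of an induced cycle of length at least `4` is not adjacent to all the others.
  rintro rfl
  by_cases h : i + 2 < m + 1
  · have := hind i (i + 2) (by omega) h (hc' _ h)
    omega
  · have := hind (i - 2) i (by omega) hi (hc' (i - 2) (by omega)).symm
    omega

end Complex

/-! ### The layers between the ends of two parallel geodesics -/

/-- The vertices on level `k` between the end `α (-∞)` and the end `β (+∞)`: those that lie on a
geodesic from `α (-M)` to `β M` at distance `M + k` from `α (-M)`, for some `M` that is so large
that `α (-M)` and `β M` are at distance `2 M + e`. -/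
def layer {V : Type*} (G : SimpleGraph V) (α β : ℤ → V) (e N : ℤ) (k : ℤ) : Set V :=
  {x | ∃ M : ℤ, N ≤ 2 * M ∧ (G.dist (α (-M)) x : ℤ) ≤ M + k ∧ (G.dist (β M) x : ℤ) ≤ M + e - k}

/-- From `N` on, the distances between the parametrized geodesics `α` and `β` are given by the
parameters up to the constant `e`. -/
structure IsAsymptotic {V : Type*} (G : SimpleGraph V) (α β : ℤ → V) (e N : ℤ) : Prop where
  dist_left : ∀ m n : ℤ, G.dist (α m) (α n) = (m - n).natAbs
  dist_right : ∀ m n : ℤ, G.dist (β m) (β n) = (m - n).natAbs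
  dist_eq : ∀ m n : ℤ, N ≤ n - m → (G.dist (α m) (β n) : ℤ) = n - m + e

section Layer

variable {V : Type*} {K : AbstractSimplicialComplex V} {α β : ℤ → V} {e N : ℤ}

theorem layer_large {G : SimpleGraph V} (hconn : G.Connected) (H : IsAsymptotic G α β e N) {k : ℤ}
    {x : V} (hx : x ∈ layer G α β e N k) :
    ∃ M₀ : ℤ, ∀ M ≥ M₀, N ≤ 2 * M ∧ (G.dist (α (-M)) x : ℤ) = M + k ∧
      (G.dist (β M) x : ℤ) = M + e - k := by
  obtain ⟨M₀, h0, h1, h2⟩ := hx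
  refine ⟨M₀, fun M hM => ?_⟩
  have h3 := hconn.dist_triangle (u := α (-M)) (v := α (-M₀)) (w := x)
  have h4 := hconn.dist_triangle (u := β M) (v := β M₀) (w := x)
  have h5 := hconn.dist_triangle (u := α (-M)) (v := x) (w := β M)
  have h6 := H.dist_eq (-M) M (by omega)
  rw [SimpleGraph.dist_comm (u := x)] at h5
  rw [H.dist_left] at h3
  rw [H.dist_right] at h4
  omega

theorem mem_layer_left {G : SimpleGraph V} (H : IsAsymptotic G α β e N) (n : ℤ) :
    α n ∈ layer G α β e N n := by
  refine ⟨|n| + |N|, ?_, ?_, ?_⟩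
  · have := le_abs_self N
    have := abs_nonneg n
    have := abs_nonneg N
    omega
  · have := neg_abs_le n
    have := abs_nonneg N
    rw [H.dist_left]
    omega
  · have := le_abs_self n
    have := le_abs_self N
    rw [SimpleGraph.dist_comm, H.dist_eq _ _ (by omega)]
    omega

theorem mem_layer_right {G : SimpleGraph V} (H : IsAsymptotic G α β e N) (n : ℤ) :
    β n ∈ layer G α β e N (n + e) := by
  refine ⟨|n| + |N|, ?_, ?_, ?_⟩
  · have := le_abs_self N
    have := abs_nonneg n
    have := abs_nonneg N
    omega
  · have := neg_abs_le n
    have := le_abs_self N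
    rw [H.dist_eq _ _ (by omega)]
    omega
  · have := le_abs_self n
    have := abs_nonneg N
    rw [H.dist_right]
    omega

theorem SatisfiesSD.exists_triangle_of_adjOrEq (hSD : SatisfiesSD K) (hconn : (skel K).Connected)
    {O x y : V} {i : ℕ} (hx : (skel K).dist O x = i + 1) (hy : (skel K).dist O y = i + 1)
    (hxy : AdjOrEq (skel K) x y) :
    ∃ t, (skel K).Adj x t ∧ (skel K).Adj y t ∧ (skel K).dist O t = i := by
  rcases hxy with rfl | hxy
  · obtain ⟨t, hxt, ht⟩ := exists_adj_dist_eq hconn hx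
    exact ⟨t, hxt, hxt, ht⟩
  · exact hSD.exists_triangle hconn hx hy hxy

/-- The conditions (T) and (V) towards `α (-M)` and towards `β M`, for large `M`, give those of a
layering. -/
theorem isLayering_layer (hSD : SatisfiesSD K) (hconn : (skel K).Connected)
    (H : IsAsymptotic (skel K) α β e N) : IsLayering (skel K) (layer (skel K) α β e N) where
  eq_of_mem hx hy := by
    obtain ⟨M₁, h₁⟩ := layer_large hconn H hx
    obtain ⟨M₂, h₂⟩ := layer_large hconn H hy
    have := h₁ (max M₁ M₂) (le_max_left _ _)
    have := h₂ (max M₁ M₂) (le_max_right _ _)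
    omega
  le_of_adj hx hy h := by
    obtain ⟨M₁, h₁⟩ := layer_large hconn H hx
    obtain ⟨M₂, h₂⟩ := layer_large hconn H hy
    have := h₁ (max M₁ M₂) (le_max_left _ _)
    have := h₂ (max M₁ M₂) (le_max_right _ _)
    have := dist_le_add_one_of_adj hconn (α (-(max M₁ M₂))) h
    omega
  le_of_common hx hy h h' := by
    obtain ⟨M₁, h₁⟩ := layer_large hconn H hx
    obtain ⟨M₂, h₂⟩ := layer_large hconn H hy
    have := h₁ (max M₁ M₂) (le_max_left _ _)
    have := h₂ (max M₁ M₂) (le_max_right _ _)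
    have := dist_le_add_one_of_adj hconn (α (-(max M₁ M₂))) h.symm
    have := dist_le_add_one_of_adj hconn (α (-(max M₁ M₂))) h'
    omega
  mem_of_adj hx hy h h' := by
    obtain ⟨M₁, h₁⟩ := layer_large hconn H hx
    obtain ⟨M₂, h₂⟩ := layer_large hconn H hy
    have := h₁ (max M₁ M₂) (le_max_left _ _)
    have := h₂ (max M₁ M₂) (le_max_right _ _)
    have := dist_le_add_one_of_adj hconn (α (-(max M₁ M₂))) h'
    have := dist_le_add_one_of_adj hconn (β (max M₁ M₂)) h
    exact ⟨max M₁ M₂, by omega, by omega, by omega⟩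
  triangle_down {k x y} hx hy h := by
    obtain ⟨M₁, h₁⟩ := layer_large hconn H hx
    obtain ⟨M₂, h₂⟩ := layer_large hconn H hy
    set M := max (max M₁ M₂) (1 - k)
    have := h₁ M (by omega)
    have := h₂ M (by omega)
    obtain ⟨t, hxt, hyt, ht⟩ := hSD.exists_triangle_of_adjOrEq hconn (O := α (-M))
      (i := (M + k - 1).toNat) (by omega) (by omega) h
    have := dist_le_add_one_of_adj hconn (β M) hxt.symm
    exact ⟨t, ⟨M, by omega, by omega, by omega⟩, hxt, hyt⟩
  triangle_up {k x y} hx hy h := by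
    obtain ⟨M₁, h₁⟩ := layer_large hconn H hx
    obtain ⟨M₂, h₂⟩ := layer_large hconn H hy
    set M := max (max M₁ M₂) (1 - e + k)
    have := h₁ M (by omega)
    have := h₂ M (by omega)
    obtain ⟨t, hxt, hyt, ht⟩ := hSD.exists_triangle_of_adjOrEq hconn (O := β M)
      (i := (M + e - k - 1).toNat) (by omega) (by omega) h
    have := dist_le_add_one_of_adj hconn (α (-M)) hxt.symm
    exact ⟨t, ⟨M, by omega, by omega, by omega⟩, hxt, hyt⟩
  vertex_down {k v x y} hv hx hy h h' := by
    obtain ⟨M₀, h₀⟩ := layer_large hconn H hv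
    obtain ⟨M₁, h₁⟩ := layer_large hconn H hx
    obtain ⟨M₂, h₂⟩ := layer_large hconn H hy
    set M := max (max M₀ M₁) M₂
    have := h₀ M (by omega)
    have := h₁ M (by omega)
    have := h₂ M (by omega)
    obtain ⟨t, hvt, hxt, hty, ht⟩ := hSD.exists_vertex hconn (O := α (-M))
      (i := (M + k - 1).toNat) (by omega) (by omega) (by omega) h h'
    have := dist_le_add_one_of_adj hconn (β M) hvt.symm
    exact ⟨t, ⟨M, by omega, by omega, by omega⟩, hvt, hxt, hty⟩
  vertex_up {k v x y} hv hx hy h h' := by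
    obtain ⟨M₀, h₀⟩ := layer_large hconn H hv
    obtain ⟨M₁, h₁⟩ := layer_large hconn H hx
    obtain ⟨M₂, h₂⟩ := layer_large hconn H hy
    set M := max (max M₀ M₁) M₂
    have := h₀ M (by omega)
    have := h₁ M (by omega)
    have := h₂ M (by omega)
    obtain ⟨t, hvt, hxt, hty, ht⟩ := hSD.exists_vertex hconn (O := β M)
      (i := (M + e - k - 1).toNat) (by omega) (by omega) (by omega) h h'
    have := dist_le_add_one_of_adj hconn (α (-M)) hvt.symm
    exact ⟨t, ⟨M, by omega, by omega, by omega⟩, hvt, hxt, hty⟩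

/-- Intervals are thin: going down from `β M`, where there is a single vertex, closeness is
inherited from layer to layer. -/
theorem close_of_mem_layer (hSD : SatisfiesSD K) (hconn : (skel K).Connected)
    (hW : Wheeled (skel K)) (H : IsAsymptotic (skel K) α β e N) {k : ℤ} {x y : V}
    (hx : x ∈ layer (skel K) α β e N k) (hy : y ∈ layer (skel K) α β e N k) :
    IsLayering.Close (skel K) (layer (skel K) α β e N) k x y := by
  have HL := isLayering_layer hSD hconn H
  obtain ⟨M₁, h₁⟩ := layer_large hconn H hx
  obtain ⟨M₂, h₂⟩ := layer_large hconn H hy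
  set M := max M₁ M₂
  obtain ⟨hN, hx1, hx2⟩ := h₁ M (by omega)
  obtain ⟨-, hy1, hy2⟩ := h₂ M (by omega)
  have key : ∀ (n : ℕ) (k : ℤ) (x y : V), (n : ℤ) = M + e - k →
      ((skel K).dist (α (-M)) x : ℤ) ≤ M + k → (skel K).dist (β M) x = n →
      ((skel K).dist (α (-M)) y : ℤ) ≤ M + k → (skel K).dist (β M) y = n →
      IsLayering.Close (skel K) (layer (skel K) α β e N) k x y := by
    intro n
    induction n with
    | zero =>
      intro k x y hk hx1 hx2 hy1 hy2
      have hxm : x ∈ layer (skel K) α β e N k := ⟨M, hN, hx1, by omega⟩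
      rw [hconn.dist_eq_zero_iff] at hx2 hy2
      exact ⟨x, hxm, .inl rfl, .inl (hx2.symm.trans hy2)⟩
    | succ n ih =>
      intro k x y hk hx1 hx2 hy1 hy2
      obtain ⟨x', hxx, hx'⟩ := exists_adj_dist_eq hconn hx2
      obtain ⟨y', hyy, hy'⟩ := exists_adj_dist_eq hconn hy2
      have h3 := dist_le_add_one_of_adj hconn (α (-M)) hxx.symm
      have h4 := dist_le_add_one_of_adj hconn (α (-M)) hyy.symm
      push_cast at hk
      exact HL.close_below hW ⟨M, hN, by omega, by omega⟩ ⟨M, hN, by omega, by omega⟩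
        (ih (k + 1) x' y' (by omega) (by omega) hx' (by omega) hy')
        ⟨M, hN, hx1, by omega⟩ ⟨M, hN, hy1, by omega⟩ hxx.symm hyy.symm
  exact key ((skel K).dist (β M) x) k x y hx2 hx1.le rfl hy1.le (by omega)

end Layer

/-! ### Axes and their parametrizations -/

section Axes

variable {V : Type*} {K : AbstractSimplicialComplex V} {h : V ≃ V}

/-- The map `γ` is a geodesic line that `h` translates by `L`. -/
structure IsAxisLine (K : AbstractSimplicialComplex V) (h : V ≃ V) (L : ℤ) (γ : ℤ → V) : Prop where
  geodesic : IsGeodesicLine K γ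
  map : ∀ n, h (γ n) = γ (n + L)

theorem IsSimplicialIsometry.adj_iff (hh : IsSimplicialIsometry K h) (x y : V) :
    (skel K).Adj (h x) (h y) ↔ (skel K).Adj x y := by
  classical
  have key : ∀ x y : V, IsSimplex K {x, y} ↔ ({x, y} : Finset V) ∈ K.faces := fun x y =>
    ⟨fun ⟨s, hs, hcoe⟩ => by
      have : s = {x, y} := by
        apply Finset.coe_injective
        simpa using hcoe
      rwa [← this], fun hs => ⟨_, hs, by simp⟩⟩
  have h1 := hh {x, y}
  rw [Finset.map_insert, Finset.map_singleton] at h1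
  change (h x ≠ h y ∧ IsSimplex K {h x, h y}) ↔ (x ≠ y ∧ IsSimplex K {x, y})
  rw [key, key]
  exact and_congr h.injective.ne_iff h1

theorem dist_map_of_adj_iff {G : SimpleGraph V} (hconn : G.Connected)
    (hh : ∀ x y, G.Adj (h x) (h y) ↔ G.Adj x y) (x y : V) : G.dist (h x) (h y) = G.dist x y := by
  apply le_antisymm
  · obtain ⟨p, hp⟩ := hconn.exists_walk_length_eq_dist x y
    let φ : G →g G := ⟨h, fun {a b} => (hh a b).2⟩
    have := SimpleGraph.dist_le (p.map φ)
    rwa [SimpleGraph.Walk.length_map, hp] at this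
  · obtain ⟨p, hp⟩ := hconn.exists_walk_length_eq_dist (h x) (h y)
    let φ : G →g G := ⟨h.symm, fun {a b} hab => (hh _ _).1 (by simpa using hab)⟩
    have := SimpleGraph.dist_le (p.map φ)
    rw [SimpleGraph.Walk.length_map, hp] at this
    simpa [φ] using this

/-- An axis has a parametrization that `h` shifts forwards by `L`. As `1 < L`, the isometry cannot
act on the axis as a reflection. -/
theorem IsAxis.exists_line (hconn : (skel K).Connected) (hh : IsSimplicialIsometry K h) {L : ℕ}
    (hL : 1 < L) {A : Set V} (hA : IsAxis K h A) (hmin : ∀ x ∈ A, cdist K (h x) x = L) :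
    ∃ γ, IsAxisLine K h L γ ∧ Set.range γ = A := by
  obtain ⟨⟨γ, hγ, rfl⟩, hinv⟩ := hA
  have hσ : ∀ n, ∃ m, γ m = h (γ n) := by
    intro n
    have h1 : h (γ n) ∈ h '' Set.range γ := ⟨_, ⟨n, rfl⟩, rfl⟩
    rwa [hinv] at h1
  choose σ hσ using hσ
  have h1 : ∀ n, (σ n - n).natAbs = L := fun n => by
    rw [← hγ, hσ]
    exact hmin _ ⟨n, rfl⟩
  have h2 : ∀ n, (σ (n + 1) - σ n).natAbs = 1 := fun n => by
    rw [← hγ, hσ, hσ]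
    refine (dist_map_of_adj_iff hconn hh.adj_iff _ _).trans ((hγ _ _).trans ?_)
    omega
  have h3 : ∀ n, σ (n + 1) - (n + 1) = σ n - n := fun n => by
    have := h1 n
    have := h1 (n + 1)
    have := h2 n
    omega
  have h4 : ∀ n, σ n - n = σ 0 - 0 := by
    intro n
    induction n using Int.induction_on with
    | zero => rfl
    | succ n ih => rw [h3, ih]
    | pred n ih =>
      have := h3 (-n - 1)
      rw [show (-(n : ℤ) - 1 + 1) = -n by ring] at this
      omega
  have h5 := h1 0
  obtain h6 | h6 : σ 0 = L ∨ σ 0 = -L := by omega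
  · refine ⟨γ, ⟨hγ, fun n => ?_⟩, rfl⟩
    rw [← hσ, show σ n = n + L by have := h4 n; omega]
  · refine ⟨fun n => γ (-n), ⟨fun a b => ?_, fun n => ?_⟩, ?_⟩
    · rw [hγ]
      omega
    · rw [← hσ, show σ (-n) = -(n + L) by have := h4 (-n); omega]
    · exact (Equiv.neg ℤ).surjective.range_comp γ

theorem IsAxisLine.map_zpow {L : ℤ} {γ : ℤ → V} (hγ : IsAxisLine K h L γ) (q n : ℤ) :
    ((h : Equiv.Perm V) ^ q) (γ n) = γ (n + q * L) := by
  induction q using Int.induction_on generalizing n with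
  | zero => simp
  | succ q ih =>
    rw [zpow_add_one, Equiv.Perm.mul_apply, hγ.map, ih]
    congr 1
    ring
  | pred q ih =>
    have h1 := hγ.map (n - L)
    rw [sub_add_cancel] at h1
    have h2 : (h : Equiv.Perm V)⁻¹ (h (γ (n - L))) = γ (n - L) := h.symm_apply_apply _
    rw [zpow_sub_one, Equiv.Perm.mul_apply, ← h1, h2, ih]
    congr 1
    ring

theorem IsAxisLine.isAxis {L : ℤ} {γ : ℤ → V} (hγ : IsAxisLine K h L γ) :
    IsAxis K h (Set.range γ) := by
  refine ⟨⟨γ, hγ.geodesic, rfl⟩, ?_⟩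
  rw [← Set.range_comp]
  have : h ∘ γ = γ ∘ Equiv.addRight L := funext fun n => hγ.map n
  rw [this]
  exact (Equiv.addRight L).surjective.range_comp γ

theorem dist_zpow {G : SimpleGraph V} (hconn : G.Connected)
    (hh : ∀ x y, G.Adj (h x) (h y) ↔ G.Adj x y) (q : ℤ) (x y : V) :
    G.dist (((h : Equiv.Perm V) ^ q) x) (((h : Equiv.Perm V) ^ q) y) = G.dist x y := by
  induction q using Int.induction_on generalizing x y with
  | zero => simp
  | succ q ih =>
    rw [zpow_add_one, Equiv.Perm.mul_apply, Equiv.Perm.mul_apply, ih, dist_map_of_adj_iff hconn hh]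
  | pred q ih =>
    have h1 : ∀ z, h ((h : Equiv.Perm V)⁻¹ z) = z := h.apply_symm_apply
    rw [zpow_sub_one, Equiv.Perm.mul_apply, Equiv.Perm.mul_apply, ih,
      ← dist_map_of_adj_iff hconn hh, h1, h1]

theorem dist_le_of_step {G : SimpleGraph V} (hconn : G.Connected) {γ : ℤ → V}
    (hγ : ∀ n, G.dist (γ n) (γ (n + 1)) ≤ 1) (a : ℤ) (k : ℕ) : G.dist (γ a) (γ (a + k)) ≤ k := by
  induction k with
  | zero => simp
  | succ k ih =>
    have h1 := hconn.dist_triangle (u := γ a) (v := γ (a + k)) (w := γ (a + k + 1))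
    have h2 := hγ (a + k)
    rw [show a + ((k + 1 : ℕ) : ℤ) = a + k + 1 by push_cast; ring]
    omega

/-- An axis stays an axis if one of its vertices, together with its translates under the powers of
`h`, is replaced by another common neighbour of the two vertices next to it. -/
theorem IsAxisLine.exists_replace (hconn : (skel K).Connected) (hh : IsSimplicialIsometry K h)
    {L : ℤ} (hL : 2 < L) {γ : ℤ → V} (hγ : IsAxisLine K h L γ) {n : ℤ} {c : V}
    (h1 : (skel K).Adj c (γ n)) (h2 : (skel K).Adj c (γ (n + 2))) :
    ∃ A, IsAxis K h A ∧ γ n ∈ A ∧ c ∈ A := by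
  set δ : ℤ → V := fun r => if r = 1 then c else γ (n + r) with hδ
  have hδ' : ∀ r, r ≠ 1 → δ r = γ (n + r) := fun r hr => if_neg hr
  set η : ℤ → V := fun m => ((h : Equiv.Perm V) ^ (m / L)) (δ (m % L)) with hη
  have hmul : ∀ q, η (q * L) = γ (n + q * L) := by
    intro q
    simp only [hη]
    rw [Int.mul_ediv_cancel _ (by omega), Int.mul_emod_left, hδ' 0 (by omega), hγ.map_zpow,
      add_zero]
  have hmap : ∀ m, h (η m) = η (m + L) := by
    intro m
    simp only [hη]
    rw [Int.add_emod_right, Int.add_ediv_of_dvd_right (dvd_refl L), Int.ediv_self (by omega),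
      add_comm (m / L) 1, zpow_add, zpow_one, Equiv.Perm.mul_apply]
  have hγstep : ∀ r, (skel K).dist (γ r) (γ (r + 1)) = 1 := fun r => by
    have := hγ.geodesic r (r + 1)
    rw [cdist] at this
    omega
  have hδstep : ∀ r, (skel K).dist (δ r) (δ (r + 1)) ≤ 1 := by
    intro r
    by_cases hr0 : r = 0
    · subst hr0
      rw [hδ' 0 (by omega)]
      simp only [hδ, zero_add, if_true, add_zero]
      exact (SimpleGraph.dist_eq_one_iff_adj.2 h1.symm).le
    · by_cases hr1 : r = 1
      · subst hr1
        rw [hδ' (1 + 1) (by omega)]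
        simp only [hδ, if_true]
        exact (SimpleGraph.dist_eq_one_iff_adj.2 h2).le
      · rw [hδ' _ hr1, hδ' (r + 1) (by omega), ← add_assoc]
        exact (hγstep _).le
  have hstep : ∀ m, (skel K).dist (η m) (η (m + 1)) ≤ 1 := by
    intro m
    have hm := Int.emod_add_mul_ediv m L
    have hm0 := Int.emod_nonneg m (show L ≠ 0 by omega)
    have hm1 := Int.emod_lt_of_pos m (show 0 < L by omega)
    by_cases hr : m % L + 1 < L
    · obtain ⟨hq, hr'⟩ := (Int.ediv_emod_unique (a := m + 1) (b := L) (r := m % L + 1)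
        (q := m / L) (by omega)).2 ⟨by omega, by omega, hr⟩
      simp only [hη]
      rw [hq, hr', dist_zpow hconn hh.adj_iff]
      exact hδstep _
    · have hm2 : m + 1 = (m / L + 1) * L := by
        rw [add_mul, one_mul, mul_comm]
        omega
      rw [hm2, hmul]
      simp only [hη]
      rw [show m % L = L - 1 by omega, hδ' _ (by omega), hγ.map_zpow]
      have := hγstep (n + (L - 1) + m / L * L)
      rw [show n + (L - 1) + m / L * L + 1 = n + (m / L + 1) * L by ring] at this
      exact this.le
  have hle : ∀ a b : ℤ, a ≤ b → (skel K).dist (η a) (η b) = b - a := by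
    intro a b hab
    have key : ∀ a b : ℤ, a ≤ b → ((skel K).dist (η a) (η b) : ℤ) ≤ b - a := by
      intro a b hab
      obtain ⟨k, rfl⟩ : ∃ k : ℕ, b = a + k := ⟨(b - a).toNat, by omega⟩
      have := dist_le_of_step hconn hstep a k
      omega
    -- The vertices at the multiples of `L` lie on the given axis.
    have ha0 := Int.emod_add_mul_ediv a L
    have ha1 := Int.emod_nonneg a (show L ≠ 0 by omega)
    have hb0 := Int.emod_add_mul_ediv b L
    have hb1 := Int.emod_lt_of_pos b (show 0 < L by omega)
    rw [mul_comm] at ha0 hb0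
    have hb2 : (b / L + 1) * L = b / L * L + L := by ring
    have h3 := key (a / L * L) a (by omega)
    have h4 := key b ((b / L + 1) * L) (by omega)
    have h5 := key a b hab
    have h6 := hγ.geodesic (n + a / L * L) (n + (b / L + 1) * L)
    rw [cdist, ← hmul, ← hmul] at h6
    have h7 := hconn.dist_triangle (u := η (a / L * L)) (v := η a) (w := η ((b / L + 1) * L))
    have h8 := hconn.dist_triangle (u := η a) (v := η b) (w := η ((b / L + 1) * L))
    omega
  have hline : IsAxisLine K h L η := by
    refine ⟨fun a b => ?_, hmap⟩
    rw [cdist]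
    rcases le_total a b with hab | hab
    · have := hle a b hab
      omega
    · have := hle b a hab
      rw [SimpleGraph.dist_comm] at this
      omega
  refine ⟨_, hline.isAxis, ⟨0, ?_⟩, ⟨1, ?_⟩⟩
  · simpa using hmul 0
  · simp only [hη]
    rw [Int.ediv_eq_zero_of_lt (by omega) (by omega), Int.emod_eq_of_lt (by omega) (by omega)]
    simp [hδ]

/-- Two axes that are translated by the same amount are asymptotic: the excess of
`d (α m) (β n)` over `n - m` is bounded below, invariant under simultaneous translation, and
decreases when `m` decreases or `n` increases. -/
theorem IsAxisLine.exists_isAsymptotic (hconn : (skel K).Connected)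
    (hh : IsSimplicialIsometry K h) {L : ℤ} (hL : 0 < L) {α β : ℤ → V}
    (hα : IsAxisLine K h L α) (hβ : IsAxisLine K h L β) :
    ∃ e N, IsAsymptotic (skel K) α β e N := by
  set F : ℤ → ℤ → ℤ := fun m n => (skel K).dist (α m) (β n) - (n - m) with hF
  have hαd : ∀ a b, (skel K).dist (α a) (α b) = (a - b).natAbs := hα.geodesic
  have hβd : ∀ a b, (skel K).dist (β a) (β b) = (a - b).natAbs := hβ.geodesic
  have hmono : ∀ m m' n n', m' ≤ m → n ≤ n' → F m' n' ≤ F m n := by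
    intro m m' n n' hm hn
    have h1 := hconn.dist_triangle (u := α m') (v := α m) (w := β n')
    have h2 := hconn.dist_triangle (u := α m) (v := β n) (w := β n')
    rw [hαd] at h1
    rw [hβd] at h2
    simp only [hF]
    omega
  have hshift : ∀ q m n, F (m + q * L) (n + q * L) = F m n := by
    intro q m n
    simp only [hF]
    rw [← hα.map_zpow, ← hβ.map_zpow, dist_zpow hconn hh.adj_iff]
    ring
  have hbound : ∀ m n, -((skel K).dist (α 0) (β 0) : ℤ) ≤ F m n := by
    intro m n
    have h0 := Int.emod_add_mul_ediv m L
    have h1 := hmono (m % L) 0 (n + -(m / L) * L) (n + -(m / L) * L)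
      (Int.emod_nonneg m (by omega)) le_rfl
    have h2 := hshift (-(m / L)) m n
    rw [show m + -(m / L) * L = m % L by rw [neg_mul, mul_comm]; omega] at h2
    rw [h2] at h1
    refine le_trans ?_ h1
    have h3 := hconn.dist_triangle (u := β 0) (v := α 0) (w := β (n + -(m / L) * L))
    rw [hβd, SimpleGraph.dist_comm (u := β 0)] at h3
    simp only [hF]
    omega
  obtain ⟨e, ⟨m₁, n₁, he⟩, hmin⟩ := Int.exists_least_of_bdd (P := fun z => ∃ m n, F m n = z)
    ⟨_, by rintro z ⟨m, n, rfl⟩; exact hbound m n⟩ ⟨_, 0, 0, rfl⟩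
  refine ⟨e, n₁ - m₁ + L, hαd, hβd, fun m n hmn => ?_⟩
  have h0 := Int.emod_add_mul_ediv (m₁ - m) L
  have h1 := Int.emod_nonneg (m₁ - m) (show L ≠ 0 by omega)
  have h2 := Int.emod_lt_of_pos (m₁ - m) hL
  rw [mul_comm] at h0
  have h3 := hmono m₁ (m + (m₁ - m) / L * L) n₁ (n + (m₁ - m) / L * L) (by omega) (by omega)
  rw [hshift, he] at h3
  have h4 := hmin (F m n) ⟨m, n, rfl⟩
  have h5 : F m n = e := le_antisymm h3 h4
  simp only [hF] at h5
  omega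

end Axes

/-! ### Connectedness and finiteness of the graph of axes -/

/-- Two lines in the layers and vertices `x n` adjacent to both in each layer: the hexagons and
octagons between them, which have centers, cannot all be degenerate. -/
theorem IsLayering.false_of_parallel {V : Type*} {G : SimpleGraph V} {J : ℤ → Set V}
    (H : IsLayering G J) (hW : Wheeled G) {a b x : ℤ → V} (hx : ∀ n, x n ∈ J n)
    (ha : ∀ n, a n ∈ J n) (hb : ∀ n, b n ∈ J n)
    (ha1 : ∀ n, G.Adj (a n) (a (n + 1))) (hb1 : ∀ n, G.Adj (b n) (b (n + 1)))
    (hxa : ∀ n, G.Adj (x n) (a n)) (hxb : ∀ n, G.Adj (x n) (b n))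
    (hab : ∀ i j, ¬ AdjOrEq G (a i) (b j))
    (hac : ∀ n c j, G.Adj c (a n) → G.Adj c (a (n + 2)) → ¬ G.Adj c (b j))
    (hbc : ∀ n c j, G.Adj c (b n) → G.Adj c (b (n + 2)) → ¬ G.Adj c (a j)) : False := by
  have ha2 : ∀ n, AdjOrEq G (a (n + 1)) (a (n + 2)) := fun n => .inr (by
    have := ha1 (n + 1)
    rwa [show n + 1 + 1 = n + 2 by ring] at this)
  have ha3 : ∀ n, AdjOrEq G (a (n + 2)) (a (n + 3)) := fun n => .inr (by
    have := ha1 (n + 2)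
    rwa [show n + 2 + 1 = n + 3 by ring] at this)
  have hb2 : ∀ n, AdjOrEq G (b (n + 1)) (b (n + 2)) := fun n => .inr (by
    have := hb1 (n + 1)
    rwa [show n + 1 + 1 = n + 2 by ring] at this)
  have hb3 : ∀ n, AdjOrEq G (b (n + 2)) (b (n + 3)) := fun n => .inr (by
    have := hb1 (n + 2)
    rwa [show n + 2 + 1 = n + 3 by ring] at this)
  have hfar : ∀ n m, n + 1 < m → ¬ AdjOrEq G (x n) (x m) := fun n m h =>
    H.not_adjOrEq (hx n) (hx m) (.inl h)
  -- An octagon through `x n` and `x (n + 2)`.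
  have step2 : ∀ (a b : ℤ → V), (∀ n, a n ∈ J n) → (∀ n, G.Adj (a n) (a (n + 1))) →
      (∀ n, AdjOrEq G (a (n + 1)) (a (n + 2))) → (∀ n, G.Adj (x n) (a n)) →
      (∀ n, G.Adj (b n) (b (n + 1))) → (∀ n, AdjOrEq G (b (n + 1)) (b (n + 2))) →
      (∀ n, G.Adj (x n) (b n)) → (∀ i j, ¬ AdjOrEq G (a i) (b j)) →
      (∀ n c j, G.Adj c (a n) → G.Adj c (a (n + 2)) → ¬ G.Adj c (b j)) →
      ∀ n, G.Adj (x n) (a (n + 1)) ∨ G.Adj (x (n + 2)) (a (n + 1)) := by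
    intro a b ha ha1 ha2 hxa hb1 hb2 hxb hab hac n
    by_contra! hcon
    obtain ⟨c, -, -, ⟨s, hs, hxs, hcs⟩, ⟨t, ht, hxt, hct⟩, ⟨u, hu, -, hcu⟩, -⟩ :=
      hW.bigon (S := {a n, a (n + 1), a (n + 2)}) (S' := Set.range b) (x := x n) (y := x (n + 2))
        (i := 2) (j := 2)
        (joined_two (by simp) (by simp) (by simp) (hxa n) (.inr (ha1 n)) (ha2 n) (hxa _))
        (joined_two ⟨_, rfl⟩ ⟨_, rfl⟩ ⟨_, rfl⟩ (hxb n) (.inr (hb1 n)) (hb2 n) (hxb _))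
        (by omega) (by
          rintro s (rfl | rfl | rfl) _ ⟨j, rfl⟩ <;> exact hab _ _) (hfar _ _ (by omega))
    obtain ⟨j, rfl⟩ := hu
    have hs' : s = a n := by
      rcases hs with rfl | rfl | rfl
      · rfl
      · exact absurd hxs hcon.1
      · have := H.le_of_adj (ha _) (hx n) hxs.symm
        omega
    have ht' : t = a (n + 2) := by
      rcases ht with rfl | rfl | rfl
      · have := H.le_of_adj (hx _) (ha n) hxt
        omega
      · exact absurd hxt hcon.2
      · rfl
    subst hs' ht'
    exact hac n c j hcs hct hcu
  -- There is no octagon through `x n` and `x (n + 3)`.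
  have step3 : ∀ n i j, i + j ≤ 4 → Joined G (Set.range a) i (x n) (x (n + 3)) →
      Joined G (Set.range b) j (x n) (x (n + 3)) → False := by
    intro n i j hij h1 h2
    obtain ⟨c, hcx, hcy, -⟩ := hW.bigon h1 h2 hij (by
      rintro _ ⟨i, rfl⟩ _ ⟨j, rfl⟩
      exact hab i j) (hfar _ _ (by omega))
    have := H.le_of_common (hx (n + 3)) (hx n) hcy hcx
    omega
  have full : ∀ (a : ℤ → V) n, (∀ n, G.Adj (a n) (a (n + 1))) →
      (∀ n, AdjOrEq G (a (n + 1)) (a (n + 2))) → (∀ n, AdjOrEq G (a (n + 2)) (a (n + 3))) →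
      (∀ n, G.Adj (x n) (a n)) → Joined G (Set.range a) 3 (x n) (x (n + 3)) :=
    fun a n h1 h2 h3 h => joined_three ⟨_, rfl⟩ ⟨_, rfl⟩ ⟨_, rfl⟩ ⟨_, rfl⟩ (h n) (.inr (h1 n))
      (h2 n) (h3 n) (h _)
  have right : ∀ (a : ℤ → V) n, (∀ n, AdjOrEq G (a (n + 1)) (a (n + 2))) →
      (∀ n, AdjOrEq G (a (n + 2)) (a (n + 3))) → (∀ n, G.Adj (x n) (a n)) →
      G.Adj (x n) (a (n + 1)) → Joined G (Set.range a) 2 (x n) (x (n + 3)) :=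
    fun a n h2 h3 h hr => joined_two ⟨_, rfl⟩ ⟨_, rfl⟩ ⟨_, rfl⟩ hr (h2 n) (h3 n) (h _)
  have left : ∀ (a : ℤ → V) n, (∀ n, G.Adj (a n) (a (n + 1))) →
      (∀ n, AdjOrEq G (a (n + 1)) (a (n + 2))) → (∀ n, G.Adj (x n) (a n)) →
      G.Adj (x (n + 3)) (a (n + 2)) → Joined G (Set.range a) 2 (x n) (x (n + 3)) :=
    fun a n h1 h2 h hl => joined_two ⟨_, rfl⟩ ⟨_, rfl⟩ ⟨_, rfl⟩ (h n) (.inr (h1 n)) (h2 n) hl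
  have hright : ∀ n, G.Adj (x n) (a (n + 1)) ∨ G.Adj (x n) (b (n + 1)) := by
    intro n
    by_contra! hcon
    have h1 := (step2 a b ha ha1 ha2 hxa hb1 hb2 hxb hab hac n).resolve_left hcon.1
    have h2 := (step2 b a hb hb1 hb2 hxb ha1 ha2 hxa (fun i j h => hab j i h.symm) hbc
      n).resolve_left hcon.2
    rw [show n + 2 = n - 1 + 3 by ring, show n + 1 = n - 1 + 2 by ring] at h1 h2
    exact step3 (n - 1) 2 2 le_rfl (left a _ ha1 ha2 hxa h1) (left b _ hb1 hb2 hxb h2)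
  have hleft : ∀ n, G.Adj (x (n + 2)) (a (n + 1)) ∨ G.Adj (x (n + 2)) (b (n + 1)) := by
    intro n
    by_contra! hcon
    have h1 := (step2 a b ha ha1 ha2 hxa hb1 hb2 hxb hab hac n).resolve_right hcon.1
    have h2 := (step2 b a hb hb1 hb2 hxb ha1 ha2 hxa (fun i j h => hab j i h.symm) hbc
      n).resolve_right hcon.2
    exact step3 n 2 2 le_rfl (right a _ ha2 ha3 hxa h1) (right b _ hb2 hb3 hxb h2)
  have hl := hleft 1
  rw [show (1 : ℤ) + 2 = 0 + 3 by norm_num, show (1 : ℤ) + 1 = 0 + 2 by norm_num] at hl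
  rcases hright 0 with hr | hr <;> rcases hl with hl | hl
  · exact step3 0 1 3 le_rfl (joined_one ⟨_, rfl⟩ ⟨_, rfl⟩ hr (ha2 0) hl)
      (full b 0 hb1 hb2 hb3 hxb)
  · exact step3 0 2 2 le_rfl (right a 0 ha2 ha3 hxa hr) (left b 0 hb1 hb2 hxb hl)
  · exact step3 0 2 2 le_rfl (left a 0 ha1 ha2 hxa hl) (right b 0 hb2 hb3 hxb hr)
  · exact step3 0 3 1 le_rfl (full a 0 ha1 ha2 ha3 hxa)
      (joined_one ⟨_, rfl⟩ ⟨_, rfl⟩ hr (hb2 0) hl)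

section GraphOfAxes

variable {V : Type*} {K : AbstractSimplicialComplex V} {h : V ≃ V}

theorem IsLocallyFinite.finite_ball (hfin : IsLocallyFinite K) (hconn : (skel K).Connected) (O : V)
    (n : ℕ) : (ball K O n).Finite := by
  induction n with
  | zero =>
    refine (Set.finite_singleton O).subset fun v hv => ?_
    have hv' : (skel K).dist O v ≤ 0 := hv
    exact (hconn.dist_eq_zero_iff.1 (by omega : (skel K).dist O v = 0)).symm
  | succ n ih =>
    have hnbr : ∀ v, {w | (skel K).Adj v w}.Finite := by
      intro v
      refine ((hfin v).biUnion fun s _ => s.finite_toSet).subset fun w hw => ?_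
      obtain ⟨-, s, hs, hcoe⟩ := hw
      have hmem : ∀ z, z ∈ s ↔ z = v ∨ z = w := fun z => by
        rw [← Finset.mem_coe, hcoe]
        simp
      exact Set.mem_biUnion ⟨hs, (hmem v).2 (.inl rfl)⟩ ((hmem w).2 (.inr rfl))
    refine (ih.union (ih.biUnion fun v _ => hnbr v)).subset fun w hw => ?_
    have hw' : (skel K).dist O w ≤ n + 1 := hw
    by_cases hle : (skel K).dist O w ≤ n
    · exact .inl hle
    · obtain ⟨t, hwt, ht⟩ := exists_adj_dist_eq hconn (by omega : (skel K).dist O w = n + 1)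
      exact .inr (Set.mem_biUnion (show (skel K).dist O t ≤ n from ht.le) hwt.symm)

theorem reachable_of_adjOrEq (A B : Axis K h) {x y : V} (hx : x ∈ A.1) (hy : y ∈ B.1)
    (hxy : AdjOrEq (skel K) x y) : (graphOfAxes K h).Reachable A B := by
  by_cases hAB : A = B
  · rw [hAB]
  · refine SimpleGraph.Adj.reachable ⟨hAB, ?_⟩
    refine (Nat.sInf_le ⟨x, hx, y, hy, rfl⟩ : dMin K A.1 B.1 ≤ cdist K x y).trans ?_
    rcases hxy with rfl | hxy
    · exact SimpleGraph.dist_self.le.trans zero_le_one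
    · exact (SimpleGraph.dist_eq_one_iff_adj.2 hxy).le

theorem Axis.exists_line (hconn : (skel K).Connected) (hhyp : IsHyperbolic K h)
    (hlen : 3 < translationLength K h) (A : Axis K h) :
    ∃ γ, IsAxisLine K h (translationLength K h) γ ∧ Set.range γ = A.1 :=
  A.2.1.exists_line hconn hhyp.1 (by omega) fun _ hx => A.2.2 hx

theorem MinIsUnionOfAxes.exists_axis (haxes : MinIsUnionOfAxes K h) {A : Set V}
    (hA : IsAxis K h A) : ∃ B : Axis K h, B.1 = A :=
  ⟨⟨A, hA, by rw [haxes]; exact Set.subset_sUnion_of_mem hA⟩, rfl⟩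

theorem MinIsUnionOfAxes.nonempty_axis (haxes : MinIsUnionOfAxes K h)
    (hconn : (skel K).Connected) : Nonempty (Axis K h) := by
  have := hconn.nonempty
  obtain ⟨x, hx⟩ := ciInf_mem (displacement K h)
  have hx' : x ∈ minSet K h := hx
  rw [haxes] at hx'
  obtain ⟨A, hA, -⟩ := hx'
  obtain ⟨B, -⟩ := haxes.exists_axis hA
  exact ⟨B⟩

/-- Two axes lie in the layers between the negative end of the first and the positive end of the
second, so that they are at distance at most `2` from each other in each layer. -/
theorem IsAxisLine.exists_layering (hconn : (skel K).Connected) (hSD : SatisfiesSD K)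
    (hW : Wheeled (skel K)) (hh : IsSimplicialIsometry K h) {L : ℤ} (hL : 0 < L) {α β : ℤ → V}
    (hα : IsAxisLine K h L α) (hβ : IsAxisLine K h L β) :
    ∃ J, IsLayering (skel K) J ∧ ∃ e, ∀ n, α n ∈ J n ∧ β (n - e) ∈ J n ∧
      ∃ c ∈ J n, AdjOrEq (skel K) (α n) c ∧ AdjOrEq (skel K) c (β (n - e)) := by
  obtain ⟨e, N, H⟩ := hα.exists_isAsymptotic hconn hh hL hβ
  refine ⟨_, isLayering_layer hSD hconn H, e, fun n => ?_⟩
  have h1 := mem_layer_left H n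
  have h2 := mem_layer_right H (n - e)
  rw [sub_add_cancel] at h2
  exact ⟨h1, h2, close_of_mem_layer hSD hconn hW H h1 h2⟩

theorem IsGeodesicLine.adj_succ {γ : ℤ → V} (hγ : IsGeodesicLine K γ) (n : ℤ) :
    (skel K).Adj (γ n) (γ (n + 1)) := by
  rw [← SimpleGraph.dist_eq_one_iff_adj]
  have := hγ n (n + 1)
  rw [cdist] at this
  omega

theorem preconnected_graphOfAxes (hconn : (skel K).Connected) (hSD : SatisfiesSD K)
    (hW : Wheeled (skel K)) (hhyp : IsHyperbolic K h) (hlen : 3 < translationLength K h)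
    (haxes : MinIsUnionOfAxes K h) : (graphOfAxes K h).Preconnected := by
  intro A B
  obtain ⟨α, hα, hαA⟩ := A.exists_line hconn hhyp hlen
  obtain ⟨β, hβ, hβB⟩ := B.exists_line hconn hhyp hlen
  have hmemA : ∀ n, α n ∈ A.1 := fun n => hαA ▸ ⟨n, rfl⟩
  have hmemB : ∀ n, β n ∈ B.1 := fun n => hβB ▸ ⟨n, rfl⟩
  obtain ⟨J, HJ, e, hJ⟩ := hα.exists_layering hconn hSD hW hhyp.1 (by omega) hβ
  choose hαJ hβJ x hxJ hαx hxβ using hJ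
  by_contra hAB
  have hfar : ∀ i j, ¬ AdjOrEq (skel K) (α i) (β j) := fun i j hij =>
    hAB (reachable_of_adjOrEq A B (hmemA i) (hmemB j) hij)
  -- The center of a hexagon or octagon is on an axis that meets one of the two axes and is
  -- adjacent to the other one.
  have hac : ∀ n c j, (skel K).Adj c (α n) → (skel K).Adj c (α (n + 2)) →
      ¬ (skel K).Adj c (β j) := by
    intro n c j h1 h2 h3
    obtain ⟨C, hC, hαC, hcC⟩ := hα.exists_replace hconn hhyp.1 (by omega) h1 h2
    obtain ⟨C, rfl⟩ := haxes.exists_axis hC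
    exact hAB ((reachable_of_adjOrEq A C (hmemA n) hαC (.refl _)).trans
      (reachable_of_adjOrEq C B hcC (hmemB j) (.inr h3)))
  have hbc : ∀ n c j, (skel K).Adj c (β n) → (skel K).Adj c (β (n + 2)) →
      ¬ (skel K).Adj c (α j) := by
    intro n c j h1 h2 h3
    obtain ⟨C, hC, hβC, hcC⟩ := hβ.exists_replace hconn hhyp.1 (by omega) h1 h2
    obtain ⟨C, rfl⟩ := haxes.exists_axis hC
    exact hAB ((reachable_of_adjOrEq A C (hmemA j) hcC (.inr h3.symm)).trans
      (reachable_of_adjOrEq C B hβC (hmemB n) (.refl _)))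
  refine HJ.false_of_parallel hW (a := α) (b := fun n => β (n - e)) (x := x) hxJ hαJ hβJ
    hα.geodesic.adj_succ (fun n => ?_) (fun n => ?_) (fun n => ?_) (fun i j => hfar i _)
    (fun n c j => hac n c _) (fun n c j h1 h2 => ?_)
  · rw [show n + 1 - e = n - e + 1 by ring]
    exact hβ.geodesic.adj_succ _
  · refine ((hαx n).symm).resolve_left fun he => hfar n (n - e) ?_
    rw [← he]
    exact hxβ n
  · refine (hxβ n).resolve_left fun he => hfar n (n - e) ?_
    rw [← he]
    exact hαx n
  · rw [show n + 2 - e = n - e + 2 by ring] at h2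
    exact hbc _ c j h1 h2

/-- All axes pass near a given vertex of an axis, and an axis is determined by a fundamental domain
for the action of `h` on it. -/
theorem finite_axis (hconn : (skel K).Connected) (hfin : IsLocallyFinite K) (hSD : SatisfiesSD K)
    (hW : Wheeled (skel K)) (hhyp : IsHyperbolic K h) (hlen : 3 < translationLength K h) :
    Finite (Axis K h) := by
  rcases isEmpty_or_nonempty (Axis K h) with hemp | ⟨⟨A₀⟩⟩
  · infer_instance
  obtain ⟨α, hα, -⟩ := A₀.exists_line hconn hhyp hlen
  set L := translationLength K h with hLdef
  set D := ball K (α 0) (2 + L) with hD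
  have : Finite D := hfin.finite_ball hconn _ _
  have hsub : ∀ A B : Axis K h, (∀ d ∈ D, d ∈ A.1 → d ∈ B.1) → A.1 ⊆ B.1 := by
    intro A B hAB
    obtain ⟨γ, hγ, hγA⟩ := A.exists_line hconn hhyp hlen
    obtain ⟨β, hβ, hβB⟩ := B.exists_line hconn hhyp hlen
    obtain ⟨J, -, e, hJ⟩ := hα.exists_layering hconn hSD hW hhyp.1 (by omega) hγ
    obtain ⟨-, -, c, -, hc1, hc2⟩ := hJ 0
    have hle : ∀ {x y : V}, AdjOrEq (skel K) x y → (skel K).dist x y ≤ 1 := by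
      rintro x y (rfl | hxy)
      · simp
      · exact (SimpleGraph.dist_eq_one_iff_adj.2 hxy).le
    rw [← hγA]
    rintro _ ⟨m, rfl⟩
    have h0 := Int.emod_add_mul_ediv (m - (0 - e)) L
    have h1 := Int.emod_nonneg (m - (0 - e)) (show (L : ℤ) ≠ 0 by omega)
    have h2 := Int.emod_lt_of_pos (m - (0 - e)) (show 0 < (L : ℤ) by omega)
    set q := (m - (0 - e)) / (L : ℤ)
    set r := (m - (0 - e)) % (L : ℤ)
    have hd : γ (0 - e + r) ∈ D := by
      change (skel K).dist (α 0) (γ (0 - e + r)) ≤ 2 + L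
      have h3 := hconn.dist_triangle (u := α 0) (v := c) (w := γ (0 - e + r))
      have h4 := hconn.dist_triangle (u := c) (v := γ (0 - e)) (w := γ (0 - e + r))
      have h5 := hle hc1
      have h6 := hle hc2
      have h7 := hγ.geodesic (0 - e) (0 - e + r)
      rw [cdist] at h7
      omega
    have h8 := hAB _ hd (hγA ▸ ⟨_, rfl⟩)
    rw [← hβB] at h8 ⊢
    obtain ⟨i, hi⟩ := h8
    refine ⟨i + q * L, ?_⟩
    rw [← hβ.map_zpow, hi, hγ.map_zpow]
    congr 1
    rw [← hLdef, mul_comm]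
    omega
  refine Finite.of_injective (fun A : Axis K h => {d : D | d.1 ∈ A.1}) fun A B hAB => ?_
  have hiff : ∀ d ∈ D, d ∈ A.1 ↔ d ∈ B.1 := fun d hd => by
    have := congrArg (fun s : Set D => (⟨d, hd⟩ : D) ∈ s) hAB
    simpa using this
  exact Subtype.ext ((hsub A B fun d hd => (hiff d hd).1).antisymm
    (hsub B A fun d hd => (hiff d hd).2))

end GraphOfAxes

end LocatedComplex

theorem theorem3p14 {V : Type u} (K : AbstractSimplicialComplex V)
    (hconn : (LocatedComplex.skel K).Connected)
    (hfin : LocatedComplex.IsLocallyFinite K)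
    (hloc : LocatedComplex.IsLocated K 8)
    (hSD : LocatedComplex.SatisfiesSD K)
    (h : V ≃ V) (hhyp : LocatedComplex.IsHyperbolic K h)
    (hlen : 3 < LocatedComplex.translationLength K h)
    (haxes : LocatedComplex.MinIsUnionOfAxes K h) :
    (LocatedComplex.graphOfAxes K h).Connected ∧
      ∃ (W : Type u) (T : SimpleGraph W), T.IsTree ∧
        ∃ f : LocatedComplex.Axis K h → W,
          LocatedComplex.IsQuasiIsometry (LocatedComplex.graphOfAxes K h) T f := by
  have hW := LocatedComplex.wheeled_skel hconn hloc hSD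
  have hne : Nonempty (LocatedComplex.Axis K h) := haxes.nonempty_axis hconn
  have := LocatedComplex.finite_axis hconn hfin hSD hW hhyp hlen
  refine ⟨⟨LocatedComplex.preconnected_graphOfAxes hconn hSD hW hhyp hlen haxes⟩,
    PUnit, ⊥, SimpleGraph.IsTree.of_subsingleton, fun _ => PUnit.unit, ?_⟩
  obtain ⟨C, hC⟩ := Finite.exists_le fun p : LocatedComplex.Axis K h × LocatedComplex.Axis K h =>
    (LocatedComplex.graphOfAxes K h).dist p.1 p.2
  have hC' : ∀ A B, ((LocatedComplex.graphOfAxes K h).dist A B : ℝ) ≤ C := fun A B => by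
    exact_mod_cast hC (A, B)
  refine ⟨1, C, le_rfl, Nat.cast_nonneg C, fun A B => ?_, fun z => ⟨hne.some, ?_⟩⟩
  · rw [SimpleGraph.dist_self, Nat.cast_zero]
    constructor
    · have := hC' A B
      linarith
    · positivity
  · rw [show z = PUnit.unit from rfl, SimpleGraph.dist_self, Nat.cast_zero]
    positivity
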